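/- Let $N=\{1,\dots,n\}$ be a set of agents and $A$ a set of $m$ alternatives, $n,m\ge 1$. Given a distribution $F$ on $[0,\infty)$, let the values $\mathrm{val}_i(a)$ ($i\in N$, $a\in A$) be drawn independently from $F$; write $v=(\mathrm{val}_i)_{i\in N}$ and $\mathrm{sw}(a,v)=\sum_{i\in N}\mathrm{val}_i(a)$. Given $v$, let the profile $P=(\succ_i)_{i\in N}$ of strict rankings of $A$ be chosen uniformly at random from the set $\mathcal P(v)$ of profiles consistent with $v$, i.e. those with $\mathrm{val}_i(a)\ge \mathrm{val}_i(a')$ whenever $a\succ_i a'$. The average distortion of a (randomized) mechanism $\mathcal M$ on $F$ is $$\frac{\mathbb E_{v\sim F}\left[\max_{a\in A}\mathrm{sw}(a,v)\right]}{\mathbb E_{v\sim F,\,P\sim\mathcal P(v)}\left[\mathrm{sw}(\mathcal M(P,v),v)\right]},$$ where the expectation in the denominator is also over the random choices of $\mathcal M$. For $p\in[0,1]$, the mechanism $\textsc{Mean}$ for binary values that equal $1$ with probability $p$ queries each agent for the value of the alternative at position $\tau=\max\{1,\lfloor pm\rfloor\}$ of her ranking, and returns an alternative $a$ that maximizes the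 number of agents whose answer is $1$ and who rank $a$ at one of the positions $1,\dots,\tau$; ties are broken arbitrarily (on the basis of the profile and the answers). The mechanism $\textsc{RtMean}$ with thresholds $0<\ell_1<\dots<\ell_k$, $k\ge 1$, draws $t\in\{1,\dots,k\}$ uniformly at random, sets $p=\Pr_{z\sim F}[z\ge \ell_t]$, makes the queries of $\textsc{Mean}$ for this $p$ (hence exactly one query per agent), replaces each answer by $1$ if it is at least $\ell_t$ and by $0$ otherwise, and returns the alternative that $\textsc{Mean}$ selects on these answers. **Theorem.** There is an absolute constant $C>0$ such that the following holds. Let $F$ be a probability distribution on $[0,\infty)$ with mean $\mu>0$ and finite variance $\sigma^2$, and let $m\ge 1$. Then there are thresholds $0<\ell_1<\dots<\ell_k$ such that for every $n\ge 1$ and every way of breaking ties, the average distortion on $F$ of $\textsc{RtMean}$ with these thresholds, for $n$ agents and $m$ alternatives, is at most $$C\cdot\max\left\{1,\ \log m+\log\frac{\sigma^2}{\mu^2}\right\}$$ (with $\log 0=-\infty$, so that the bound is $C$ if $\sigma=0$). -/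

import Mathlib

open MeasureTheory ProbabilityTheory
open scoped NNReal ENNReal

noncomputable section

namespace AvgDistortion

/-- A ranking of the alternatives `Fin m`: it sends an alternative to its place, where place `0`
is the top of the ranking. -/
abbrev Ranking (m : ℕ) : Type := Equiv.Perm (Fin m)

/-- The position of an alternative in a ranking, counted from `1`. -/
def pos {m : ℕ} (r : Ranking m) (a : Fin m) : ℕ := (r a : ℕ) + 1

/-- The alternative at position `j`, for `1 ≤ j ≤ m`. -/
def altAt {m : ℕ} [NeZero m] (r : Ranking m) (j : ℕ) : Fin m := r.symm (Fin.ofNat m (j - 1))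

/-- One ranking for each of the agents `Fin n`. -/
abbrev Profile (n m : ℕ) : Type := Fin n → Ranking m

/-- `v i a` is the value of agent `i` for alternative `a`. -/
abbrev Valuations (n m : ℕ) : Type := Fin n → Fin m → ℝ≥0

/-- An alternative is ranked above another one only if its value is at least as large. -/
def Consistent {m : ℕ} (r : Ranking m) (u : Fin m → ℝ≥0) : Prop :=
  ∀ a b : Fin m, pos r a < pos r b → u b ≤ u a

open Classical in
/-- The (nonempty) set of profiles that are consistent with the valuations `v`. -/
def consistentProfiles {n m : ℕ} (v : Valuations n m) : Finset (Profile n m) :=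
  Finset.univ.filter fun P => ∀ i, Consistent (P i) (v i)

/-- The social welfare of an alternative. -/
def socialWelfare {n m : ℕ} (a : Fin m) (v : Valuations n m) : ℝ≥0 := ∑ i, v i a

/-- The maximum social welfare over all alternatives. -/
def maxWelfare {n m : ℕ} (v : Valuations n m) : ℝ≥0 :=
  Finset.univ.sup fun a => socialWelfare a v

/-- The law of random valuations whose entries are independent with distribution `F`. -/
def valuationLaw (n m : ℕ) (F : Measure ℝ≥0) : Measure (Valuations n m) :=
  Measure.pi fun _ : Fin n => Measure.pi fun _ : Fin m => F

/-- A randomized mechanism: for each profile and valuations, the law of the winner. -/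
abbrev Mechanism (n m : ℕ) : Type := Profile n m → Valuations n m → PMF (Fin m)

/-- The expected social welfare of the winner, over the randomness of the mechanism. -/
def winnerWelfare {n m : ℕ} (M : Mechanism n m) (P : Profile n m) (v : Valuations n m) : ℝ≥0∞ :=
  ∑ a, M P v a * (socialWelfare a v : ℝ≥0∞)

/-- The expected social welfare of the winner when the valuations `v` have independent entries
with law `F`, the profile is uniform among those consistent with `v`, and the mechanism draws its
own random bits. -/
def expectedWelfare {n m : ℕ} (M : Mechanism n m) (F : Measure ℝ≥0) : ℝ≥0∞ :=
  ∫⁻ v, ((consistentProfiles v).card : ℝ≥0∞)⁻¹ * ∑ P ∈ consistentProfiles v, winnerWelfare M P v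
    ∂(valuationLaw n m F)

/-- The expected maximum social welfare. -/
def expectedMaxWelfare (n m : ℕ) (F : Measure ℝ≥0) : ℝ≥0∞ :=
  ∫⁻ v, (maxWelfare v : ℝ≥0∞) ∂(valuationLaw n m F)

/-- The average distortion of a mechanism on the distribution `F`. The quotient is taken in
`[0, ∞]`, so it is `∞` if the mechanism achieves expected welfare `0` while the optimum is
positive. -/
def avgDistortion {n m : ℕ} (M : Mechanism n m) (F : Measure ℝ≥0) : ℝ≥0∞ :=
  expectedMaxWelfare n m F / expectedWelfare M F

/-- The answers of the agents when each of them is asked for her value for the alternative at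
position `j` of her ranking. -/
def answers {n m : ℕ} [NeZero m] (P : Profile n m) (v : Valuations n m) (j : ℕ) : Fin n → ℝ≥0 :=
  fun i => v i (altAt (P i) j)

open Classical in
/-- The implied social welfare of `a` when `x i` is the answer of agent `i` to the query for the
value of the alternative at position `j` of her ranking. -/
def impliedWelfare {n m : ℕ} (a : Fin m) (P : Profile n m) (x : Fin n → ℝ≥0) (j : ℕ) : ℕ :=
  ∑ i, if x i = 1 ∧ pos (P i) a ≤ j then 1 else 0

/-- The position that the mechanism Mean queries on the binary distribution with success
probability `p`. -/
def queryPos (m : ℕ) (p : ℝ) : ℕ := max 1 ⌊p * m⌋₊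

/-- `S` is the decision rule of the mechanism Mean for the binary distribution with success
probability `p`: from the profile and the answers to the queries at position `queryPos m p`, it
computes an alternative of maximum implied social welfare. Different such `S` are different ways
of breaking ties. -/
def IsMeanRule {n m : ℕ} (p : ℝ) (S : Profile n m → (Fin n → ℝ≥0) → Fin m) : Prop :=
  ∀ (P : Profile n m) (x : Fin n → ℝ≥0) (a : Fin m),
    impliedWelfare a P x (queryPos m p) ≤ impliedWelfare (S P x) P x (queryPos m p)

/-- The probability that a value drawn from `F` is at least `l`. -/
def tailProb (F : Measure ℝ≥0) (l : ℝ≥0) : ℝ := F.real (Set.Ici l)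

open Classical in
/-- The answer `z` to a query, read as a binary value with respect to the threshold `l`. -/
def binarize (l z : ℝ≥0) : ℝ≥0 := if l ≤ z then 1 else 0

/-- The mechanism RtMean with thresholds `l`: draw `t` uniformly at random, make the queries of
Mean for the binary distribution with success probability `tailProb F (l t)`, and apply the
decision rule `S t` of Mean to the binarized answers. -/
def rtMean {n m k : ℕ} [NeZero m] [NeZero k] (F : Measure ℝ≥0) (l : Fin k → ℝ≥0)
    (S : Fin k → Profile n m → (Fin n → ℝ≥0) → Fin m) : Mechanism n m :=
  fun P v => (PMF.uniformOfFintype (Fin k)).map fun t =>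
    S t P fun i => binarize (l t) (answers P v (queryPos m (tailProb F (l t))) i)

open Classical in
/-- `max {1, log m + log (σ² / μ²)}`, where `log 0 = -∞`. -/
def logRate (m : ℕ) (μ σ : ℝ) : ℝ :=
  if σ = 0 then 1 else max 1 (Real.log m + Real.log (σ ^ 2 / μ ^ 2))

end AvgDistortion

end

open AvgDistortion

/-! Say that an agent approves the alternatives of value at least `l`. For one threshold `l` with `p
= tailProb F l` and `τ = max 1 ⌊p * m⌋`, the expected maximum implied welfare is at least 1/150 of
the expected maximum number of approvals (`lintegral_supLoad_le_impliedMax`). Four facts give this.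
Truncation: lowering the value of a loser keeps the winner, so an agent who approves the winner
approves at most `1 + p * m` alternatives on average. By Markov, agents with more than `6 * τ`
approvals can be dropped at the cost of a factor 2. Symmetry: a consistent ranking puts the approved
alternatives on top, and in functions that depend on `v` only through approval counts the profile
may be taken uniform and independent of `v` (`lintegral_consistentAvg`). Covering: up to `6 * τ` top
positions are covered by 6 cyclic shifts of the first `τ`, at the cost of a factor 6.
Anti-concentration: an agent approves at least `⌊p * m⌋` alternatives with probability at least 2/25
(`measureReal_floor_le_countGE`).

For general `F`, take `k` thresholds doubling from `μ / 4`, with `k` of the order of `logRate`.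
Values below `μ / 4` contribute at most `n * μ / 4` to the optimum; by the variance bound, so do
values beyond the dyadic range. The optimum is at least `n * μ`, so at least half of it comes from
the `k` thresholds, and drawing one of them at random costs a factor `k`. -/

namespace AvgDistortion

/-! ### Indicators and maximum column sums -/

open Classical in
/-- The `0`-`1` indicator of a proposition. -/
noncomputable def ind (p : Prop) : ℝ≥0∞ := if p then 1 else 0

lemma ind_of {p : Prop} (h : p) : ind p = 1 := if_pos h

lemma ind_of_not {p : Prop} (h : ¬p) : ind p = 0 := if_neg h

lemma ind_le_one (p : Prop) : ind p ≤ 1 := by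
  unfold ind; split_ifs <;> simp

lemma ind_mono {p q : Prop} (h : p → q) : ind p ≤ ind q := by
  by_cases hp : p
  · rw [ind_of (h hp)]; exact ind_le_one p
  · simp [ind_of_not hp]

lemma ind_and (p q : Prop) : ind (p ∧ q) = ind p * ind q := by
  by_cases hp : p <;> by_cases hq : q <;> simp [ind, hp, hq]

lemma measurable_ind {α : Type*} [MeasurableSpace α] {s : Set α} (hs : MeasurableSet s) :
    Measurable fun x => ind (x ∈ s) :=
  Measurable.ite hs measurable_const measurable_const

lemma lintegral_ind {α : Type*} [MeasurableSpace α] (ν : Measure α) {s : Set α}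
    (hs : MeasurableSet s) : ∫⁻ x, ind (x ∈ s) ∂ν = ν s := by
  rw [← lintegral_indicator_one hs]
  refine lintegral_congr fun x => ?_
  by_cases h : x ∈ s <;> simp [ind, h]

/-- The largest column sum. -/
noncomputable def supLoad {n m : ℕ} (X : Fin n → Fin m → ℝ≥0∞) : ℝ≥0∞ := ⨆ a, ∑ i, X i a

lemma le_supLoad {n m : ℕ} (X : Fin n → Fin m → ℝ≥0∞) (a : Fin m) : ∑ i, X i a ≤ supLoad X :=
  le_iSup (fun a => ∑ i, X i a) a

lemma supLoad_le {n m : ℕ} {X : Fin n → Fin m → ℝ≥0∞} {c : ℝ≥0∞} (h : ∀ a, ∑ i, X i a ≤ c) :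
    supLoad X ≤ c := iSup_le h

lemma supLoad_mono {n m : ℕ} {X Y : Fin n → Fin m → ℝ≥0∞} (h : ∀ i a, X i a ≤ Y i a) :
    supLoad X ≤ supLoad Y :=
  iSup_mono fun a => Finset.sum_le_sum fun i _ => h i a

lemma exists_supLoad_eq {n m : ℕ} [NeZero m] (X : Fin n → Fin m → ℝ≥0∞) :
    ∃ a, supLoad X = ∑ i, X i a := by
  obtain ⟨a, ha⟩ := exists_eq_ciSup_of_finite (f := fun a => ∑ i, X i a)
  exact ⟨a, ha.symm⟩

lemma supLoad_sum_le {n m : ℕ} {ι : Type*} (s : Finset ι) (X : ι → Fin n → Fin m → ℝ≥0∞) :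
    supLoad (fun i a => ∑ j ∈ s, X j i a) ≤ ∑ j ∈ s, supLoad (X j) := by
  refine supLoad_le fun a => ?_
  rw [Finset.sum_comm]
  exact Finset.sum_le_sum fun j _ => le_supLoad (X j) a

lemma supLoad_add_le {n m : ℕ} (X Y : Fin n → Fin m → ℝ≥0∞) :
    supLoad (fun i a => X i a + Y i a) ≤ supLoad X + supLoad Y := by
  refine supLoad_le fun a => ?_
  rw [Finset.sum_add_distrib]
  exact add_le_add (le_supLoad X a) (le_supLoad Y a)

lemma supLoad_const_mul {n m : ℕ} (c : ℝ≥0∞) (X : Fin n → Fin m → ℝ≥0∞) :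
    supLoad (fun i a => c * X i a) = c * supLoad X := by
  simp only [supLoad, ← Finset.mul_sum, ENNReal.mul_iSup]

lemma measurable_supLoad {α : Type*} [MeasurableSpace α] {n m : ℕ}
    {X : α → Fin n → Fin m → ℝ≥0∞} (h : ∀ i a, Measurable fun x => X x i a) :
    Measurable fun x => supLoad (X x) :=
  Measurable.iSup fun a => Finset.measurable_sum _ fun i _ => h i a

/-! ### Approval counts and consistent rankings -/

/-- The number of alternatives of value at least `l`. -/
noncomputable def countGE {m : ℕ} (l : ℝ≥0) (u : Fin m → ℝ≥0) : ℕ := Fintype.card {a // l ≤ u a}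

lemma countGE_comp_perm {m : ℕ} (l : ℝ≥0) (u : Fin m → ℝ≥0) (π : Equiv.Perm (Fin m)) :
    countGE l (u ∘ π) = countGE l u :=
  Fintype.card_congr (π.subtypeEquiv fun _ => Iff.rfl)

lemma countGE_eq_sum {m : ℕ} (l : ℝ≥0) (u : Fin m → ℝ≥0) :
    countGE l u = ∑ a, if l ≤ u a then 1 else 0 := by
  rw [countGE, Fintype.card_subtype, Finset.card_filter]

lemma coe_countGE {m : ℕ} (l : ℝ≥0) (u : Fin m → ℝ≥0) :
    (countGE l u : ℝ≥0∞) = ∑ a, ind (l ≤ u a) := by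
  rw [countGE_eq_sum]; push_cast
  refine Finset.sum_congr rfl fun a _ => ?_
  by_cases h : l ≤ u a <;> simp [ind, h]

lemma measurable_countGE {m : ℕ} (l : ℝ≥0) :
    Measurable (countGE l : (Fin m → ℝ≥0) → ℕ) := by
  have : (countGE l : (Fin m → ℝ≥0) → ℕ) = fun u => ∑ a, if l ≤ u a then 1 else 0 :=
    funext fun u => countGE_eq_sum l u
  rw [this]
  exact Finset.measurable_sum _ fun a _ =>
    Measurable.ite (measurableSet_le measurable_const (measurable_pi_apply a))
      measurable_const measurable_const

lemma Consistent.antitone {m : ℕ} {r : Ranking m} {u : Fin m → ℝ≥0} (h : Consistent r u) :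
    Antitone (u ∘ r.symm) := by
  intro x y hxy
  rcases hxy.eq_or_lt with rfl | hlt
  · exact le_rfl
  · exact h _ _ (by simpa [pos] using hlt)

/-- Values decrease along the ranking, so the approved alternatives fill an initial segment of it.
Hence one query at a position decides whether everything down to it is approved. -/
lemma Consistent.le_iff {m : ℕ} {r : Ranking m} {u : Fin m → ℝ≥0} (h : Consistent r u)
    (l : ℝ≥0) (a : Fin m) : l ≤ u a ↔ (r a : ℕ) < countGE l u := by
  have := Tuple.lt_card_ge_iff_apply_ge_of_antitone (j := r a) (a := l) h.antitone
  rw [← countGE_comp_perm l u r.symm]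
  rw [countGE, Fintype.card_subtype]
  simpa using this.symm

lemma exists_consistent {m : ℕ} (u : Fin m → ℝ≥0) : ∃ r : Ranking m, Consistent r u := by
  let f : Fin m → ℝ≥0ᵒᵈ := fun a => OrderDual.toDual (u a)
  refine ⟨(Tuple.sort f).symm, fun a b hab => ?_⟩
  have := Tuple.monotone_sort f (a := (Tuple.sort f).symm a) (b := (Tuple.sort f).symm b)
    (by simp only [pos] at hab; exact Fin.le_def.2 (by omega))
  simpa [f] using this

lemma mem_consistentProfiles {n m : ℕ} {v : Valuations n m} {P : Profile n m} :
    P ∈ consistentProfiles v ↔ ∀ i, Consistent (P i) (v i) := by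
  simp [consistentProfiles]

lemma consistentProfiles_nonempty {n m : ℕ} (v : Valuations n m) :
    (consistentProfiles v).Nonempty := by
  choose r hr using fun i => exists_consistent (v i)
  exact ⟨r, mem_consistentProfiles.2 hr⟩

/-! ### Symmetry: from consistent profiles to uniform ones -/

/-- The average of `f` over the profiles that are consistent with `v`. -/
noncomputable def consistentAvg {n m : ℕ} (v : Valuations n m) (f : Profile n m → ℝ≥0∞) : ℝ≥0∞ :=
  ((consistentProfiles v).card : ℝ≥0∞)⁻¹ * ∑ P ∈ consistentProfiles v, f P

/-- The average of `f` over all profiles. -/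
noncomputable def profileAvg {n m : ℕ} (f : Profile n m → ℝ≥0∞) : ℝ≥0∞ :=
  (Fintype.card (Profile n m) : ℝ≥0∞)⁻¹ * ∑ P, f P

lemma consistentAvg_mono {n m : ℕ} (v : Valuations n m) {f g : Profile n m → ℝ≥0∞}
    (h : ∀ P ∈ consistentProfiles v, f P ≤ g P) : consistentAvg v f ≤ consistentAvg v g := by
  unfold consistentAvg
  gcongr with P hP
  exact h P hP

lemma consistentAvg_const {n m : ℕ} (v : Valuations n m) (c : ℝ≥0∞) :
    consistentAvg v (fun _ => c) = c := by
  have h : ((consistentProfiles v).card : ℝ≥0∞) ≠ 0 := by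
    simpa using (consistentProfiles_nonempty v).ne_empty
  rw [consistentAvg, Finset.sum_const, nsmul_eq_mul, ← mul_assoc,
    ENNReal.inv_mul_cancel h (ENNReal.natCast_ne_top _), one_mul]

lemma consistentAvg_congr {n m : ℕ} (v : Valuations n m) {f g : Profile n m → ℝ≥0∞}
    (h : ∀ P ∈ consistentProfiles v, f P = g P) : consistentAvg v f = consistentAvg v g := by
  unfold consistentAvg
  rw [Finset.sum_congr rfl h]

lemma profileAvg_mono {n m : ℕ} {f g : Profile n m → ℝ≥0∞} (h : ∀ P, f P ≤ g P) :
    profileAvg f ≤ profileAvg g := by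
  unfold profileAvg
  gcongr with P
  exact h P

lemma profileAvg_comp_mul_left {n m : ℕ} (f : Profile n m → ℝ≥0∞) (Q : Profile n m) :
    profileAvg (fun P => f (Q * P)) = profileAvg f := by
  unfold profileAvg
  rw [Equiv.sum_comp (Equiv.mulLeft Q) f |>.symm]
  rfl

lemma profileAvg_sum {n m : ℕ} {ι : Type*} (s : Finset ι) (f : ι → Profile n m → ℝ≥0∞) :
    profileAvg (fun P => ∑ j ∈ s, f j P) = ∑ j ∈ s, profileAvg (f j) := by
  unfold profileAvg
  rw [Finset.sum_comm, Finset.mul_sum]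

lemma profileAvg_const_mul {n m : ℕ} (c : ℝ≥0∞) (f : Profile n m → ℝ≥0∞) :
    profileAvg (fun P => c * f P) = c * profileAvg f := by
  unfold profileAvg
  rw [← Finset.mul_sum, mul_left_comm]

instance {n m : ℕ} (F : Measure ℝ≥0) [IsProbabilityMeasure F] :
    IsProbabilityMeasure (valuationLaw n m F) := by
  unfold valuationLaw; infer_instance

/-- Permute the alternatives separately for each agent. -/
def permute {n m : ℕ} (Q : Profile n m) (v : Valuations n m) : Valuations n m :=
  fun i => v i ∘ Q i

lemma measurePreserving_permute {n m : ℕ} (F : Measure ℝ≥0) [IsProbabilityMeasure F]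
    (Q : Profile n m) :
    MeasurePreserving (permute Q) (valuationLaw n m F) (valuationLaw n m F) := by
  refine measurePreserving_pi (f := fun i (u : Fin m → ℝ≥0) => u ∘ Q i) _ _ fun i => ?_
  convert measurePreserving_piCongrLeft (fun _ : Fin m => F) (Q i).symm using 1
  funext u a
  simp [MeasurableEquiv.coe_piCongrLeft, Equiv.piCongrLeft, Equiv.piCongrLeft']

lemma mem_consistentProfiles_permute {n m : ℕ} (v : Valuations n m) (P Q : Profile n m) :
    P * Q ∈ consistentProfiles (permute Q v) ↔ P ∈ consistentProfiles v := by
  simp only [mem_consistentProfiles]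
  refine forall_congr' fun i => ⟨fun h a b hab => ?_, fun h a b hab => ?_⟩
  · simpa [permute] using h ((Q i).symm a) ((Q i).symm b) (by simpa [pos] using hab)
  · exact h _ _ hab

lemma consistentAvg_permute {n m : ℕ} (v : Valuations n m) (Q : Profile n m)
    (f : Profile n m → ℝ≥0∞) :
    consistentAvg (permute Q v) f = consistentAvg v fun P => f (P * Q) := by
  have h : consistentProfiles (permute Q v) =
      (consistentProfiles v).map (Equiv.mulRight Q).toEmbedding := by
    ext P
    rw [Finset.mem_map_equiv, ← mem_consistentProfiles_permute v _ Q]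
    simp
  unfold consistentAvg
  rw [h, Finset.card_map, Finset.sum_map]
  rfl

lemma measurableSet_mem_consistentProfiles {n m : ℕ} (P : Profile n m) :
    MeasurableSet {v : Valuations n m | P ∈ consistentProfiles v} := by
  have : {v : Valuations n m | P ∈ consistentProfiles v} =
      ⋂ i, ⋂ a, ⋂ b, ⋂ (_ : pos (P i) a < pos (P i) b), {v | v i b ≤ v i a} := by
    ext v; simp [mem_consistentProfiles, Consistent]
  rw [this]
  refine MeasurableSet.iInter fun i => MeasurableSet.iInter fun a => MeasurableSet.iInter fun b =>
    MeasurableSet.iInter fun _ => measurableSet_le ?_ ?_ <;> fun_prop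

lemma measurable_consistentAvg {n m : ℕ} {f : Valuations n m → Profile n m → ℝ≥0∞}
    (hf : ∀ P, Measurable fun v => f v P) : Measurable fun v => consistentAvg v (f v) := by
  -- The range of summation varies with `v`; summing over all profiles with indicator weights makes
  -- measurability visible.
  have h : ∀ v, consistentAvg v (f v) =
      (∑ P, ind (P ∈ consistentProfiles v))⁻¹ * ∑ P, ind (P ∈ consistentProfiles v) * f v P := by
    intro v
    have hsum : ∀ g : Profile n m → ℝ≥0∞, ∑ P, ind (P ∈ consistentProfiles v) * g P =
        ∑ P ∈ consistentProfiles v, g P := fun g => by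
      rw [← Finset.sum_subset (Finset.subset_univ (consistentProfiles v))
        fun P _ hP => by simp [ind_of_not hP]]
      exact Finset.sum_congr rfl fun P hP => by simp [ind_of hP]
    have hcard := hsum fun _ => 1
    simp only [mul_one, Finset.sum_const, nsmul_eq_mul] at hcard
    rw [hsum, hcard, consistentAvg]
  simp only [h]
  refine Measurable.mul (Measurable.inv ?_) ?_
  · exact Finset.measurable_sum _ fun P _ => measurable_ind (measurableSet_mem_consistentProfiles P)
  · exact Finset.measurable_sum _ fun P _ =>
      (measurable_ind (measurableSet_mem_consistentProfiles P)).mul (hf P)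

/-- For each fixed `P`, the product `P * Q` is uniform when `Q` is. -/
lemma profileAvg_consistentAvg {n m : ℕ} (v : Valuations n m) (f : Profile n m → ℝ≥0∞) :
    profileAvg (fun Q => consistentAvg v fun P => f (P * Q)) = profileAvg f := by
  have : ∀ Q, consistentAvg v (fun P => f (P * Q)) = ∑ P ∈ consistentProfiles v,
      ((consistentProfiles v).card : ℝ≥0∞)⁻¹ * f (P * Q) := fun Q => by
    rw [consistentAvg, Finset.mul_sum]
  simp only [this, profileAvg_sum, profileAvg_const_mul, profileAvg_comp_mul_left]
  rw [← Finset.mul_sum]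
  exact consistentAvg_const v _

lemma lintegral_profileAvg {n m : ℕ} {α : Type*} [MeasurableSpace α] (ν : Measure α)
    {f : α → Profile n m → ℝ≥0∞} (hf : ∀ P, Measurable fun v => f v P) :
    ∫⁻ v, profileAvg (f v) ∂ν = profileAvg fun P => ∫⁻ v, f v P ∂ν := by
  unfold profileAvg
  rw [lintegral_const_mul _ (Finset.measurable_sum _ fun P _ => hf P),
    lintegral_finsetSum _ fun P _ => hf P]

lemma profileAvg_const {n m : ℕ} (c : ℝ≥0∞) : profileAvg (fun _ : Profile n m => c) = c := by
  rw [profileAvg, Finset.sum_const, nsmul_eq_mul, ← mul_assoc, Finset.card_univ,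
    ENNReal.inv_mul_cancel (by simp) (ENNReal.natCast_ne_top _), one_mul]

/-- Averaging over the consistent profiles amounts to averaging over all profiles, for functions
that depend on the valuations in a permutation invariant way. -/
lemma lintegral_consistentAvg {n m : ℕ} (F : Measure ℝ≥0) [IsProbabilityMeasure F]
    {f : Valuations n m → Profile n m → ℝ≥0∞} (hf : ∀ P, Measurable fun v => f v P)
    (hinv : ∀ v Q, f (permute Q v) = f v) :
    ∫⁻ v, consistentAvg v (f v) ∂valuationLaw n m F =
      ∫⁻ v, profileAvg (f v) ∂valuationLaw n m F := by
  -- Replacing `v` by `permute Q v` preserves the law and `f`, but turns each consistent `P` into `P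
  -- * Q`. Averaging over `Q` then makes the profile uniform.
  have key : ∀ Q : Profile n m, ∫⁻ v, consistentAvg v (f v) ∂valuationLaw n m F =
      ∫⁻ v, consistentAvg v (fun P => f v (P * Q)) ∂valuationLaw n m F := fun Q => by
    rw [← (measurePreserving_permute F Q).lintegral_comp (measurable_consistentAvg hf)]
    simp only [consistentAvg_permute, hinv]
  rw [← profileAvg_const (n := n) (m := m) (∫⁻ v, consistentAvg v (f v) ∂valuationLaw n m F)]
  calc _ = profileAvg fun Q => ∫⁻ v, consistentAvg v (fun P => f v (P * Q))
        ∂valuationLaw n m F := by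
        unfold profileAvg
        rw [Finset.sum_congr rfl fun Q _ => key Q]
    _ = ∫⁻ v, profileAvg (fun Q => consistentAvg v (fun P => f v (P * Q)))
        ∂valuationLaw n m F :=
        (lintegral_profileAvg _ fun Q => measurable_consistentAvg fun P => hf _).symm
    _ = _ := by simp only [profileAvg_consistentAvg]

/-! ### Truncation: supporters of the winner approve few alternatives -/

/-- Resampling one entry of the valuations does not change their law. -/
lemma lintegral_resample {n m : ℕ} (F : Measure ℝ≥0) [IsProbabilityMeasure F] (i : Fin n)
    (a : Fin m) {f : Valuations n m → ℝ≥0∞} (hf : Measurable f) :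
    ∫⁻ v, f v ∂valuationLaw n m F =
      ∫⁻ v, ∫⁻ z, f (Function.update v i (Function.update (v i) a z)) ∂F ∂valuationLaw n m F := by
  have hu : Measurable fun q : Valuations n m × ℝ≥0 =>
      Function.update q.1 i (Function.update (q.1 i) a q.2) := by
    refine measurable_pi_iff.2 fun j => measurable_pi_iff.2 fun b => ?_
    by_cases hj : j = i
    · subst hj
      by_cases hb : b = a
      · subst hb; simpa using measurable_snd
      · simp only [Function.update_self, Function.update_of_ne hb]; fun_prop
    · simp only [Function.update_of_ne hj]; fun_prop
  have hg : Measurable fun v : Valuations n m =>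
      ∫⁻ z, f (Function.update v i (Function.update (v i) a z)) ∂F :=
    (hf.comp hu).lintegral_prod_right'
  -- It suffices to compare marginals, first over the row of agent `i`, then over the entry `a` of
  -- that row.
  refine lintegral_eq_of_lmarginal_eq {i} hf hg ?_
  rw [lmarginal_singleton, lmarginal_singleton]
  funext v
  simp only [Function.update_self, Function.update_idem]
  have hf' : Measurable fun u : Fin m → ℝ≥0 => f (Function.update v i u) :=
    hf.comp (measurable_update v)
  refine lintegral_eq_of_lmarginal_eq {a} hf' ?_ ?_
  · exact ((hf'.comp measurable_update').lintegral_prod_right' :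
      Measurable fun u : Fin m → ℝ≥0 => ∫⁻ z, f (Function.update v i (Function.update u a z)) ∂F)
  · rw [lmarginal_singleton, lmarginal_singleton]
    simp

/-- The number of agents whose value for `a` is at least `l`. -/
noncomputable def colCount {n m : ℕ} (l : ℝ≥0) (v : Valuations n m) (a : Fin m) : ℕ :=
  ∑ i, if l ≤ v i a then 1 else 0

lemma coe_colCount {n m : ℕ} (l : ℝ≥0) (v : Valuations n m) (a : Fin m) :
    (colCount l v a : ℝ≥0∞) = ∑ i, ind (l ≤ v i a) := by
  unfold colCount; push_cast
  refine Finset.sum_congr rfl fun i _ => ?_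
  by_cases h : l ≤ v i a <;> simp [ind, h]

lemma measurable_colCount {n m : ℕ} (l : ℝ≥0) (a : Fin m) :
    Measurable fun v : Valuations n m => colCount l v a :=
  Finset.measurable_sum _ fun i _ => Measurable.ite
    (measurableSet_le measurable_const (by fun_prop)) measurable_const measurable_const

/-- `b` is the first alternative for which the most agents have value at least `l`. -/
def IsFirstMax {n m : ℕ} (l : ℝ≥0) (v : Valuations n m) (b : Fin m) : Prop :=
  ∀ c, colCount l v c < colCount l v b ∨ (colCount l v c = colCount l v b ∧ b ≤ c)

lemma exists_isFirstMax {n m : ℕ} [NeZero m] (l : ℝ≥0) (v : Valuations n m) :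
    ∃ b, IsFirstMax l v b := by
  obtain ⟨b, -, hb⟩ := Finset.exists_max_image Finset.univ
    (fun c => toLex (colCount l v c, OrderDual.toDual c)) Finset.univ_nonempty
  refine ⟨b, fun c => ?_⟩
  simpa [Prod.Lex.le_iff] using hb c (Finset.mem_univ c)

lemma IsFirstMax.eq {n m : ℕ} {l : ℝ≥0} {v : Valuations n m} {b c : Fin m}
    (hb : IsFirstMax l v b) (hc : IsFirstMax l v c) : b = c := by
  have h₁ := hb c
  have h₂ := hc b
  apply le_antisymm <;> omega

/-- Breaking ties by index makes the winner unique, so these indicators form a partition of unity.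
-/
lemma IsFirstMax.sum_ind_mul {n m : ℕ} {l : ℝ≥0} {v : Valuations n m} {b : Fin m}
    (hb : IsFirstMax l v b) (g : Fin m → ℝ≥0∞) : ∑ c, ind (IsFirstMax l v c) * g c = g b := by
  rw [Finset.sum_eq_single b, ind_of hb, one_mul]
  · intro c _ hc
    rw [ind_of_not fun h => hc (h.eq hb), zero_mul]
  · simp

lemma IsFirstMax.supLoad_eq {n m : ℕ} {l : ℝ≥0} {v : Valuations n m} {b : Fin m}
    (hb : IsFirstMax l v b) : supLoad (fun i a => ind (l ≤ v i a)) = ∑ i, ind (l ≤ v i b) := by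
  refine le_antisymm (supLoad_le fun c => ?_) (le_supLoad (fun i a => ind (l ≤ v i a)) b)
  rw [← coe_colCount, ← coe_colCount]
  have := hb c
  exact_mod_cast (by omega : colCount l v c ≤ colCount l v b)

lemma measurableSet_isFirstMax {n m : ℕ} (l : ℝ≥0) (b : Fin m) :
    MeasurableSet {v : Valuations n m | IsFirstMax l v b} := by
  have : {v : Valuations n m | IsFirstMax l v b} = ⋂ c, ({v | colCount l v c < colCount l v b} ∪
      ({v | colCount l v c = colCount l v b} ∩ {_v | b ≤ c})) := by
    ext v; simp [IsFirstMax]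
  rw [this]
  exact MeasurableSet.iInter fun c =>
    (measurableSet_lt (measurable_colCount l c) (measurable_colCount l b)).union
      ((measurableSet_eq_fun (measurable_colCount l c) (measurable_colCount l b)).inter
        (MeasurableSet.const _))

lemma measurable_ind_le {n m : ℕ} (l : ℝ≥0) (i : Fin n) (a : Fin m) :
    Measurable fun v : Valuations n m => ind (l ≤ v i a) :=
  measurable_ind (s := {v : Valuations n m | l ≤ v i a})
    (measurableSet_le measurable_const (by fun_prop))

/-- Lowering the value of an agent for an alternative does not hurt the other alternatives. -/
lemma IsFirstMax.update {n m : ℕ} {l : ℝ≥0} {v : Valuations n m} {a b : Fin m} {i : Fin n}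
    (hb : IsFirstMax l v b) (hab : a ≠ b) (hia : l ≤ v i a) (z : ℝ≥0) :
    IsFirstMax l (Function.update v i (Function.update (v i) a z)) b := by
  set w := Function.update v i (Function.update (v i) a z) with hw
  have hne : ∀ c, c ≠ a → ∀ j, w j c = v j c := fun c hc j => by
    by_cases hj : j = i
    · subst hj; simp [hw, hc]
    · simp [hw, hj]
  have heq : ∀ c, c ≠ a → colCount l w c = colCount l v c := fun c hc => by
    simp only [colCount, hne c hc]
  have hle : colCount l w a ≤ colCount l v a := by
    refine Finset.sum_le_sum fun j _ => ?_
    by_cases hj : j = i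
    · subst hj; simp only [hia, if_true]; split_ifs <;> simp
    · simp [hw, hj]
  intro c
  rw [heq b hab.symm]
  have := hb c
  by_cases hc : c = a
  · subst hc; omega
  · rwa [heq c hc]

/-- Supporting the winner does not make it more likely to support another given alternative. -/
lemma lintegral_isFirstMax_mul_le {n m : ℕ} (F : Measure ℝ≥0) [IsProbabilityMeasure F] (l : ℝ≥0)
    {a b : Fin m} (hab : a ≠ b) (i : Fin n) :
    ∫⁻ v, ind (IsFirstMax l v b) * ind (l ≤ v i b) * ind (l ≤ v i a) ∂valuationLaw n m F ≤
      F (Set.Ici l) * ∫⁻ v, ind (IsFirstMax l v b) * ind (l ≤ v i b) ∂valuationLaw n m F := by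
  have hG : Measurable fun v : Valuations n m => ind (IsFirstMax l v b) * ind (l ≤ v i b) :=
    (measurable_ind (measurableSet_isFirstMax l b)).mul (measurable_ind_le l i b)
  have hGa : Measurable fun v : Valuations n m =>
      ind (IsFirstMax l v b) * ind (l ≤ v i b) * ind (l ≤ v i a) :=
    hG.mul (measurable_ind_le l i a)
  rw [lintegral_resample F i a hGa, lintegral_resample F i a hG,
    ← lintegral_const_mul']
  swap
  · exact measure_ne_top _ _
  refine lintegral_mono fun v => ?_
  set G : ℝ≥0 → ℝ≥0∞ := fun z =>
    ind (IsFirstMax l (Function.update v i (Function.update (v i) a z)) b) *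
      ind (l ≤ Function.update v i (Function.update (v i) a z) i b) with hGdef
  -- If `b` wins while `i` approves `a`, it still wins after any change of that entry. So `G`
  -- attains its infimum wherever `l ≤ z`, and the infimum is at most the mean of `G`.
  have hGle : ∀ z z', G z * ind (l ≤ z) ≤ G z' * ind (l ≤ z) := by
    intro z z'
    by_cases hz : l ≤ z
    · refine mul_le_mul_left ?_ _
      refine mul_le_mul' (ind_mono fun h => ?_) (le_of_eq ?_)
      · simpa using h.update (a := a) (i := i) hab (by simpa using hz) z'
      · simp [hab.symm]
    · simp [ind_of_not hz]
  calc ∫⁻ z, G z * ind (l ≤ Function.update v i (Function.update (v i) a z) i a) ∂F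
      = ∫⁻ z, G z * ind (l ≤ z) ∂F := by simp
    _ ≤ ∫⁻ z, (⨅ z', G z') * ind (l ≤ z) ∂F := by
        refine lintegral_mono fun z => ?_
        by_cases hz : l ≤ z
        · simpa [ind_of hz] using fun z' => by simpa [ind_of hz] using hGle z z'
        · simp [ind_of_not hz]
    _ = (⨅ z', G z') * F (Set.Ici l) := by
        have hm : Measurable fun z : ℝ≥0 => ind (l ≤ z) := measurable_ind measurableSet_Ici
        rw [lintegral_const_mul _ hm]
        congr 1
        exact lintegral_ind F (measurableSet_Ici (a := l))
    _ ≤ F (Set.Ici l) * ∫⁻ z, G z ∂F := by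
        rw [mul_comm]
        gcongr
        calc (⨅ z', G z') = ∫⁻ _, (⨅ z', G z') ∂F := by simp
          _ ≤ _ := lintegral_mono fun z => iInf_le _ z

/-- Those who support the winner do not support many alternatives on average. -/
lemma lintegral_isFirstMax_mul_countGE_le {n m : ℕ} (F : Measure ℝ≥0) [IsProbabilityMeasure F]
    (l : ℝ≥0) (i : Fin n) (b : Fin m) :
    ∫⁻ v, ind (IsFirstMax l v b) * ind (l ≤ v i b) * countGE l (v i) ∂valuationLaw n m F ≤
      (1 + m * F (Set.Ici l)) *
        ∫⁻ v, ind (IsFirstMax l v b) * ind (l ≤ v i b) ∂valuationLaw n m F := by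
  have hG : Measurable fun v : Valuations n m => ind (IsFirstMax l v b) * ind (l ≤ v i b) :=
    (measurable_ind (measurableSet_isFirstMax l b)).mul (measurable_ind_le l i b)
  set D := ∫⁻ v, ind (IsFirstMax l v b) * ind (l ≤ v i b) ∂valuationLaw n m F with hD
  simp only [coe_countGE, Finset.mul_sum]
  have hGa : ∀ a, Measurable fun v : Valuations n m =>
      ind (IsFirstMax l v b) * ind (l ≤ v i b) * ind (l ≤ v i a) :=
    fun a => hG.mul (measurable_ind_le l i a)
  rw [lintegral_finsetSum _ fun a _ => hGa a]
  calc _ ≤ ∑ a : Fin m, (ind (a = b) * D + F (Set.Ici l) * D) := by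
        refine Finset.sum_le_sum fun a _ => ?_
        by_cases hab : a = b
        · rw [ind_of hab, one_mul]
          refine le_add_right (lintegral_mono fun v => ?_)
          calc _ ≤ ind (IsFirstMax l v b) * ind (l ≤ v i b) * 1 := by
                gcongr; exact ind_le_one _
            _ = _ := mul_one _
        · exact le_add_left (lintegral_isFirstMax_mul_le F l hab i)
    _ = _ := by
        rw [Finset.sum_add_distrib, ← Finset.sum_mul]
        have h1 : ∑ a : Fin m, ind (a = b) = 1 := by
          rw [Finset.sum_eq_single b (fun a _ h => ind_of_not h) (by simp), ind_of rfl]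
        rw [h1, Finset.sum_const, nsmul_eq_mul, Finset.card_univ, Fintype.card_fin]
        ring

/-- Agents who support too many alternatives may be disregarded. -/
lemma lintegral_supLoad_le_truncated {n m : ℕ} [NeZero m] (F : Measure ℝ≥0)
    [IsProbabilityMeasure F] (l : ℝ≥0) (K : ℕ) (hK : 2 * (1 + m * F (Set.Ici l)) ≤ K) :
    ∫⁻ v, supLoad (fun i a => ind (l ≤ v i a)) ∂valuationLaw n m F ≤
      2 * ∫⁻ v, supLoad (fun i a => ind (l ≤ v i a) * ind (countGE l (v i) ≤ K))
        ∂valuationLaw n m F := by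
  have hG : ∀ b i, Measurable fun v : Valuations n m =>
      ind (IsFirstMax l v b) * ind (l ≤ v i b) := fun b i =>
    (measurable_ind (measurableSet_isFirstMax l b)).mul (measurable_ind_le l i b)
  have hk : ∀ i, Measurable fun v : Valuations n m => (countGE l (v i) : ℝ≥0∞) := fun i =>
    (measurable_from_top (f := fun k : ℕ => (k : ℝ≥0∞))).comp
      ((measurable_countGE l).comp (measurable_pi_apply i))
  set X := ∫⁻ v, supLoad (fun i a => ind (l ≤ v i a)) ∂valuationLaw n m F with hX
  set Y := ∫⁻ v, supLoad (fun i a => ind (l ≤ v i a) * ind (countGE l (v i) ≤ K))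
        ∂valuationLaw n m F with hY
  -- Finiteness allows `X / 2` to be cancelled at the end.
  have hXtop : X ≠ ∞ := by
    refine ne_top_of_le_ne_top (ENNReal.natCast_ne_top n) ?_
    calc X ≤ ∫⁻ _, (n : ℝ≥0∞) ∂valuationLaw n m F := by
          refine lintegral_mono fun v => supLoad_le fun a => ?_
          calc _ ≤ ∑ _i : Fin n, (1 : ℝ≥0∞) := Finset.sum_le_sum fun i _ => ind_le_one _
            _ = n := by simp
      _ = n := by simp
  have hK0 : (K : ℝ≥0∞) ≠ 0 := by
    rintro h
    rw [h] at hK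
    simp at hK
  have hXeq : X = ∑ b, ∑ i, ∫⁻ v, ind (IsFirstMax l v b) * ind (l ≤ v i b)
      ∂valuationLaw n m F := by
    rw [hX]
    simp only [← lintegral_finsetSum _ fun i _ => hG _ i]
    rw [← lintegral_finsetSum _ fun b _ => Finset.measurable_sum _ fun i _ => hG b i]
    refine lintegral_congr fun v => ?_
    obtain ⟨b, hb⟩ := exists_isFirstMax l v
    simp only [← Finset.mul_sum]
    rw [hb.supLoad_eq, hb.sum_ind_mul]
  have hT : ∑ b, ∑ i, ∫⁻ v, ind (IsFirstMax l v b) * ind (l ≤ v i b) * countGE l (v i)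
      ∂valuationLaw n m F ≤ (1 + m * F (Set.Ici l)) * X := by
    rw [hXeq, Finset.mul_sum]
    refine Finset.sum_le_sum fun b _ => ?_
    rw [Finset.mul_sum]
    exact Finset.sum_le_sum fun i _ => lintegral_isFirstMax_mul_countGE_le F l i b
  have hpt : ∀ v : Valuations n m, supLoad (fun i a => ind (l ≤ v i a)) ≤
      (K : ℝ≥0∞)⁻¹ * (∑ b, ∑ i, ind (IsFirstMax l v b) * ind (l ≤ v i b) * countGE l (v i)) +
      supLoad (fun i a => ind (l ≤ v i a) * ind (countGE l (v i) ≤ K)) := by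
    intro v
    obtain ⟨b, hb⟩ := exists_isFirstMax l v
    simp only [mul_assoc, ← Finset.mul_sum]
    rw [hb.supLoad_eq, hb.sum_ind_mul, Finset.mul_sum]
    refine le_trans ?_ (add_le_add_right (le_supLoad _ b) _)
    rw [← Finset.sum_add_distrib]
    refine Finset.sum_le_sum fun i _ => ?_
    by_cases h : countGE l (v i) ≤ K
    · simp [ind_of h]
    -- A dropped agent has more than `K` approvals, so the term weighted by `countGE / K` pays for
    -- it.
    · rw [mul_left_comm]
      refine le_add_right (le_mul_of_one_le_right' ?_)
      rw [mul_comm, ← div_eq_mul_inv, ENNReal.le_div_iff_mul_le (Or.inl hK0) (by simp), one_mul]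
      exact_mod_cast (by omega : K ≤ countGE l (v i))
  -- Markov: `hK` says that `(1 + m * F (Set.Ici l)) / K` is at most 1/2.
  have hXY : X ≤ 2⁻¹ * X + Y := by
    calc X ≤ _ := lintegral_mono hpt
      _ = (K : ℝ≥0∞)⁻¹ * (∑ b, ∑ i, ∫⁻ v, ind (IsFirstMax l v b) * ind (l ≤ v i b) *
            countGE l (v i) ∂valuationLaw n m F) + Y := by
          have hm : ∀ b i, Measurable fun v : Valuations n m =>
            ind (IsFirstMax l v b) * ind (l ≤ v i b) * countGE l (v i) :=
            fun b i => (hG b i).mul (hk i)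
          have hm' := fun b => Finset.measurable_sum Finset.univ fun i _ => hm b i
          rw [lintegral_add_left ((Finset.measurable_sum _ fun b _ => hm' b).const_mul _),
            lintegral_const_mul _ (Finset.measurable_sum _ fun b _ => hm' b),
            lintegral_finsetSum _ fun b _ => hm' b]
          simp only [lintegral_finsetSum _ fun i _ => hm _ i]
          rfl
      _ ≤ (K : ℝ≥0∞)⁻¹ * ((1 + m * F (Set.Ici l)) * X) + Y := by gcongr
      _ ≤ _ := by
          rw [← mul_assoc]
          gcongr
          rw [mul_comm, ← div_eq_mul_inv]
          refine ENNReal.div_le_of_le_mul ?_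
          rw [← ENNReal.div_eq_inv_mul, ENNReal.le_div_iff_mul_le (by simp) (by simp), mul_comm]
          exact hK
  have hhalf : 2⁻¹ * X + 2⁻¹ * X ≤ 2⁻¹ * X + Y := by
    rwa [← add_mul, ENNReal.inv_two_add_inv_two, one_mul]
  have h2 : 2⁻¹ * X ≤ Y :=
    (ENNReal.add_le_add_iff_left (ENNReal.mul_ne_top (by simp) hXtop)).1 hhalf
  calc X = 2 * (2⁻¹ * X) := by
        rw [← mul_assoc, ENNReal.mul_inv_cancel (by simp) (by simp), one_mul]
    _ ≤ 2 * Y := by gcongr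

/-! ### Moments and anti-concentration of approval counts -/

/-- The first, second and fourth moments of a sum of bounded, centered, independent random
variables of equal variance. -/
lemma moments_sum_of_iIndepFun {Ω ι : Type*} [MeasurableSpace Ω] {ν : Measure Ω}
    [IsProbabilityMeasure ν] {Y : ι → Ω → ℝ} (hY : ∀ i, Measurable (Y i)) (hind : iIndepFun Y ν)
    (hb : ∀ i ω, |Y i ω| ≤ 1) (h1 : ∀ i, ∫ ω, Y i ω ∂ν = 0) {w : ℝ}
    (h2 : ∀ i, ∫ ω, Y i ω ^ 2 ∂ν = w) (s : Finset ι) :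
    ∫ ω, ∑ i ∈ s, Y i ω ∂ν = 0 ∧ ∫ ω, (∑ i ∈ s, Y i ω) ^ 2 ∂ν = s.card * w ∧
      ∫ ω, (∑ i ∈ s, Y i ω) ^ 4 ∂ν ≤ 3 * (s.card * w) ^ 2 + s.card * w := by
  classical
  induction s using Finset.induction_on with
  | empty => simp
  | insert a s ha ih =>
    obtain ⟨ih1, ih2, ih4⟩ := ih
    set S : Ω → ℝ := fun ω => ∑ i ∈ s, Y i ω with hS
    have hSm : Measurable S := Finset.measurable_sum _ fun i _ => hY i
    have hSb : ∀ ω, |S ω| ≤ s.card := fun ω => by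
      calc |S ω| ≤ ∑ i ∈ s, |Y i ω| := Finset.abs_sum_le_sum_abs _ _
        _ ≤ ∑ _i ∈ s, (1 : ℝ) := Finset.sum_le_sum fun i _ => hb i ω
        _ = s.card := by simp
    have hSY : IndepFun S (Y a) ν := by
      have := hind.indepFun_finsetSum_of_notMem hY ha
      convert this using 1
      funext ω; simp [hS]
    have hint : ∀ j k : ℕ, Integrable (fun ω => S ω ^ j * Y a ω ^ k) ν := fun j k => by
      refine Integrable.of_bound ((hSm.pow_const j).mul ((hY a).pow_const k)).aestronglyMeasurable
        ((s.card : ℝ) ^ j) (ae_of_all _ fun ω => ?_)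
      rw [Real.norm_eq_abs, abs_mul, abs_pow, abs_pow]
      calc |S ω| ^ j * |Y a ω| ^ k ≤ (s.card : ℝ) ^ j * 1 := by
            gcongr
            · exact hSb ω
            · exact pow_le_one₀ (abs_nonneg _) (hb a ω)
        _ = _ := mul_one _
    have hprod : ∀ j k : ℕ, ∫ ω, S ω ^ j * Y a ω ^ k ∂ν =
        (∫ ω, S ω ^ j ∂ν) * ∫ ω, Y a ω ^ k ∂ν := fun j k =>
      hSY.integral_fun_comp_mul_comp (f := fun x => x ^ j) (g := fun x => x ^ k)
        hSm.aemeasurable (hY a).aemeasurable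
        (measurable_id.pow_const j).aestronglyMeasurable
        (measurable_id.pow_const k).aestronglyMeasurable
    have hY1 : ∫ ω, Y a ω ^ 1 ∂ν = 0 := by simpa using h1 a
    have hS1 : ∫ ω, S ω ^ 1 ∂ν = 0 := by simpa using ih1
    have hY4 : ∫ ω, Y a ω ^ 4 ∂ν ≤ w := by
      rw [← h2 a]
      refine integral_mono (by simpa using hint 0 4) (by simpa using hint 0 2) fun ω => ?_
      have : Y a ω ^ 2 ≤ 1 := by
        rw [← sq_abs]; exact pow_le_one₀ (abs_nonneg _) (hb a ω)
      have h0 := sq_nonneg (Y a ω)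
      simp only
      nlinarith
    have hsum : ∀ ω, ∑ i ∈ insert a s, Y i ω = S ω + Y a ω := fun ω => by
      rw [Finset.sum_insert ha, add_comm]
    have hint1 : ∀ j, Integrable (fun ω => S ω ^ j) ν := fun j => by simpa using hint j 0
    have hint2 : ∀ k, Integrable (fun ω => Y a ω ^ k) ν := fun k => by simpa using hint 0 k
    have hcard : ((insert a s).card : ℝ) = s.card + 1 := by
      rw [Finset.card_insert_of_notMem ha]; push_cast; rfl
    simp only [hsum, hcard]
    refine ⟨?_, ?_, ?_⟩
    · have := integral_add (hint1 1) (hint2 1)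
      rw [hS1, hY1] at this
      simpa using this
    · have e : ∀ ω, (S ω + Y a ω) ^ 2 = S ω ^ 2 + 2 * (S ω ^ 1 * Y a ω ^ 1) + Y a ω ^ 2 :=
        fun ω => by ring
      simp only [e]
      rw [integral_add ((hint1 2).fun_add ((hint 1 1).const_mul 2)) (hint2 2),
        integral_add (hint1 2) ((hint 1 1).const_mul 2), integral_const_mul, hprod, hY1, h2, ih2]
      ring
    · have e : ∀ ω, (S ω + Y a ω) ^ 4 = S ω ^ 4 + 4 * (S ω ^ 3 * Y a ω ^ 1) +
          6 * (S ω ^ 2 * Y a ω ^ 2) + 4 * (S ω ^ 1 * Y a ω ^ 3) + Y a ω ^ 4 := fun ω => by ring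
      simp only [e]
      have i1 := (hint1 4).fun_add ((hint 3 1).const_mul 4)
      have i2 := i1.fun_add ((hint 2 2).const_mul 6)
      have i3 := i2.fun_add ((hint 1 3).const_mul 4)
      rw [integral_add i3 (hint2 4), integral_add i2 ((hint 1 3).const_mul 4),
        integral_add i1 ((hint 2 2).const_mul 6), integral_add (hint1 4) ((hint 3 1).const_mul 4),
        integral_const_mul, integral_const_mul, integral_const_mul, hprod, hprod, hprod, hY1, h2,
        ih2, hS1]
      -- With `s` for the cardinality, the surviving terms are at most `3 * (s * w) ^ 2 + s * w + 6
      -- * s * w ^ 2 + w`, which is `3 * w ^ 2` below the target.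
      nlinarith [sq_nonneg w]

/-- A bounded function that is positive at most on `A` bounds the measure of `A` from below. -/
lemma integral_le_mul_measureReal {Ω : Type*} [MeasurableSpace Ω] {ν : Measure Ω}
    [IsProbabilityMeasure ν] {f : Ω → ℝ} (hf : Integrable f ν) {A : Set Ω} (hA : MeasurableSet A)
    {c : ℝ} (h1 : ∀ ω ∈ A, f ω ≤ c) (h0 : ∀ ω ∉ A, f ω ≤ 0) :
    ∫ ω, f ω ∂ν ≤ c * ν.real A := by
  calc ∫ ω, f ω ∂ν ≤ ∫ ω, A.indicator (fun _ => c) ω ∂ν := by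
        refine integral_mono hf ((integrable_const c).indicator hA) fun ω => ?_
        by_cases h : ω ∈ A
        · simpa [h] using h1 ω h
        · simpa [h] using h0 ω h
    _ = c * ν.real A := by
        rw [integral_indicator_const _ hA, smul_eq_mul, mul_comm]

/-- A binomial random variable is not much smaller than its mean with constant probability. -/
lemma measureReal_floor_le_countGE {m : ℕ} (F : Measure ℝ≥0) [IsProbabilityMeasure F] (l : ℝ≥0) :
    2 / 25 ≤ (Measure.pi fun _ : Fin m => F).real
      {u | ⌊tailProb F l * m⌋₊ ≤ countGE l u} := by
  set ν := Measure.pi fun _ : Fin m => F with hν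
  set p := tailProb F l with hp
  have hp0 : 0 ≤ p := measureReal_nonneg
  have hp1 : p ≤ 1 := measureReal_le_one
  set y : ℝ≥0 → ℝ := fun z => (Set.Ici l).indicator (fun _ => (1 : ℝ)) z - p with hy
  have hym : Measurable y :=
    (measurable_const.indicator measurableSet_Ici).sub measurable_const
  have hyc : ∀ z, y z = 1 - p ∨ y z = - p := fun z => by
    by_cases h : z ∈ Set.Ici l <;> simp [hy, h]
  set Y : Fin m → (Fin m → ℝ≥0) → ℝ := fun a u => y (u a) with hY
  have hYm : ∀ a, Measurable (Y a) := fun a => hym.comp (measurable_pi_apply a)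
  have hYb : ∀ a u, |Y a u| ≤ 1 := fun a u => by
    rw [abs_le]
    rcases hyc (u a) with h | h <;> simp only [hY, h] <;> constructor <;> linarith
  have hind : iIndepFun Y ν := iIndepFun_pi fun _ => hym.aemeasurable
  have hI : ∫ z, (Set.Ici l).indicator (fun _ => (1 : ℝ)) z ∂F = p := by
    rw [integral_indicator_const _ measurableSet_Ici]; simp [hp, tailProb]
  have hIi : Integrable ((Set.Ici l).indicator (fun _ => (1 : ℝ))) F :=
    (integrable_const 1).indicator measurableSet_Ici
  have hcoord : ∀ (g : ℝ → ℝ), Measurable g → ∀ a, ∫ u, g (Y a u) ∂ν = ∫ z, g (y z) ∂F :=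
    fun g hg a => integral_comp_eval (μ := fun _ : Fin m => F) (i := a)
      (hg.comp hym).aestronglyMeasurable
  have h1 : ∀ a, ∫ u, Y a u ∂ν = 0 := fun a => by
    rw [hcoord (fun x => x) measurable_id a, hy, integral_sub hIi (integrable_const p), hI]
    simp
  have h2 : ∀ a, ∫ u, Y a u ^ 2 ∂ν = p * (1 - p) := fun a => by
    rw [hcoord (fun x => x ^ 2) (measurable_id.pow_const 2) a]
    have e : ∀ z, y z ^ 2 = (1 - 2 * p) * (Set.Ici l).indicator (fun _ => (1 : ℝ)) z + p ^ 2 :=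
      fun z => by
        by_cases h : z ∈ Set.Ici l <;> simp [hy, h]
        ring
    simp only [e]
    rw [integral_add (hIi.const_mul _) (integrable_const _), integral_const_mul, hI]
    simp
    ring
  obtain ⟨m1, m2, m4⟩ := moments_sum_of_iIndepFun hYm hind hYb h1 h2 Finset.univ
  rw [Finset.card_univ, Fintype.card_fin] at m2 m4
  set S : (Fin m → ℝ≥0) → ℝ := fun u => ∑ a, Y a u with hS
  set V : ℝ := m * (p * (1 - p)) with hV
  have hSc : ∀ u, S u = countGE l u - p * m := fun u => by
    rw [countGE_eq_sum]
    simp only [hS, hY, hy, Finset.sum_sub_distrib]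
    push_cast
    simp [Set.indicator_apply]
    ring
  have hSm : Measurable S := Finset.measurable_sum _ fun a _ => hYm a
  have hint : ∀ j : ℕ, Integrable (fun u => S u ^ j) ν := fun j => by
    refine Integrable.of_bound (hSm.pow_const j).aestronglyMeasurable ((m : ℝ) ^ j)
      (ae_of_all _ fun u => ?_)
    rw [Real.norm_eq_abs, abs_pow]
    gcongr
    calc |S u| ≤ ∑ a, |Y a u| := Finset.abs_sum_le_sum_abs _ _
      _ ≤ ∑ _a : Fin m, (1 : ℝ) := Finset.sum_le_sum fun a _ => hYb a u
      _ = m := by simp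
  set A : Set (Fin m → ℝ≥0) := {u | ⌊p * m⌋₊ ≤ countGE l u} with hA
  have hAm : MeasurableSet A := measurableSet_le measurable_const (measurable_countGE l)
  -- Off `A` the integer count is at most `⌊p * m⌋ - 1`, hence at least 1 below its mean.
  have hAS : ∀ u ∉ A, S u ≤ -1 := fun u hu => by
    have hlt : countGE l u + 1 ≤ ⌊p * m⌋₊ := by simpa [hA] using hu
    have := (Nat.cast_le (α := ℝ)).2 hlt
    push_cast at this
    have hfl := Nat.floor_le (show 0 ≤ p * m by positivity)
    rw [hSc]; linarith
  by_cases hVs : V < 1 / 2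
  -- Small variance: `1 - S ^ 2` is nonpositive off `A` and has mean `1 - V > 1 / 2`.
  · have := integral_le_mul_measureReal (ν := ν) (f := fun u => 1 - S u ^ 2) (c := 1)
      ((integrable_const 1).sub (hint 2)) hAm (fun u _ => by nlinarith [sq_nonneg (S u)])
      (fun u hu => by nlinarith [hAS u hu])
    rw [integral_sub (integrable_const 1) (hint 2), m2] at this
    simp at this
    linarith
  · have hV0 : 1 / 2 ≤ V := not_lt.1 hVs
    set r := Real.sqrt V with hr
    have hr0 : 0 < r := Real.sqrt_pos.2 (by linarith)
    have hr2 : r ^ 2 = V := Real.sq_sqrt (by linarith)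
    -- With `t = S / r`, the test function `t + 4/5 t² - 2/25 t⁴` is at most 5 and nonpositive for
    -- `t ≤ 0`. As `t` has mean 0, variance 1 and fourth moment at most `3 + 1 / V ≤ 5`, its mean is
    -- at least 4/5 - 2/5 = 2/5, so `A` has measure at least 2/25.
    set f : (Fin m → ℝ≥0) → ℝ := fun u =>
      r⁻¹ * S u ^ 1 + (4 / 5 * V⁻¹) * S u ^ 2 - (2 / 25 * (V⁻¹) ^ 2) * S u ^ 4 with hf
    have hfy : ∀ u, f u = (S u / r) + 4 / 5 * (S u / r) ^ 2 - 2 / 25 * (S u / r) ^ 4 := fun u => by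
      simp only [hf, ← hr2]
      field_simp
    have i12 := ((hint 1).const_mul r⁻¹).fun_add ((hint 2).const_mul (4 / 5 * V⁻¹))
    have i4 := (hint 4).const_mul (2 / 25 * (V⁻¹) ^ 2)
    have := integral_le_mul_measureReal (ν := ν) (f := f) (c := 5) (i12.sub i4) hAm
      (fun u _ => by
        rw [hfy]
        set t := S u / r
        nlinarith [sq_nonneg (t ^ 2 - 6), sq_nonneg (t - 5 / 2)])
      (fun u hu => by
        rw [hfy]
        have hneg : S u / r ≤ 0 := div_nonpos_of_nonpos_of_nonneg (by linarith [hAS u hu]) hr0.le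
        set t := S u / r
        have : 0 ≤ 1 + 4 / 5 * t - 2 / 25 * t ^ 3 := by
          nlinarith [mul_nonneg (neg_nonneg.2 hneg) (sq_nonneg (t + 9 / 5))]
        nlinarith)
    rw [hf, integral_sub i12 i4, integral_add ((hint 1).const_mul r⁻¹)
      ((hint 2).const_mul (4 / 5 * V⁻¹)), integral_const_mul, integral_const_mul,
      integral_const_mul, m2] at this
    simp only [pow_one, m1] at this
    have hVinv : V⁻¹ * V = 1 := inv_mul_cancel₀ (by linarith)
    have hVle : V⁻¹ ≤ 2 := by
      rw [inv_le_comm₀ (by linarith) (by norm_num)]; linarith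
    have hVi0 : 0 ≤ V⁻¹ := inv_nonneg.2 (by linarith)
    have h4 : (V⁻¹) ^ 2 * ∫ u, S u ^ 4 ∂ν ≤ 5 := by
      calc (V⁻¹) ^ 2 * ∫ u, S u ^ 4 ∂ν ≤ (V⁻¹) ^ 2 * (3 * V ^ 2 + V) := by gcongr
        _ = 3 * (V⁻¹ * V) ^ 2 + (V⁻¹ * V) * V⁻¹ := by ring
        _ ≤ 5 := by rw [hVinv]; linarith
    nlinarith

/-! ### The binary case: covering by shifts and the factor 150 -/

/-- The largest number of agents who have an alternative among their first `τ` ones, where only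
the agents with at least `τ` alternatives of value at least `l` count. -/
noncomputable def impliedMax {n m : ℕ} (l : ℝ≥0) (τ : ℕ) (v : Valuations n m)
    (P : Profile n m) : ℝ≥0∞ :=
  supLoad fun i a => ind (τ ≤ countGE l (v i)) * ind ((P i a : ℕ) < τ)

lemma measurable_ind_countGE {n m : ℕ} (l : ℝ≥0) (i : Fin n) (s : Set ℕ) :
    Measurable fun v : Valuations n m => ind (countGE l (v i) ∈ s) :=
  measurable_ind (s := {v : Valuations n m | countGE l (v i) ∈ s})
    (((measurable_countGE l).comp (measurable_pi_apply i)) (MeasurableSet.of_discrete))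

lemma measurable_impliedMax {n m : ℕ} (l : ℝ≥0) (τ : ℕ) (P : Profile n m) :
    Measurable fun v : Valuations n m => impliedMax l τ v P :=
  measurable_supLoad fun i _ => (measurable_ind_countGE l i (Set.Ici τ)).mul_const _

lemma impliedMax_permute {n m : ℕ} (l : ℝ≥0) (τ : ℕ) (v : Valuations n m) (Q : Profile n m) :
    impliedMax l τ (permute Q v) = impliedMax l τ v := by
  funext P
  simp only [impliedMax, permute, countGE_comp_perm]

lemma one_le_queryPos (m : ℕ) (p : ℝ) : 1 ≤ queryPos m p := le_max_left _ _

lemma queryPos_le {m : ℕ} [NeZero m] {p : ℝ} (hp : p ≤ 1) : queryPos m p ≤ m := by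
  refine max_le (Nat.pos_of_ne_zero (NeZero.ne m)) (Nat.floor_le_of_le ?_)
  have : (0 : ℝ) ≤ m := Nat.cast_nonneg m
  nlinarith

/-- The positions below `k ≤ j * τ` are covered by `j` cyclic shifts of the first `τ` positions. -/
lemma exists_shift_cover (m τ j : ℕ) [NeZero m] (hτ : 1 ≤ τ) :
    ∃ c : Fin j → Equiv.Perm (Fin m), ∀ (x : Fin m) (k : ℕ), (x : ℕ) < k → k ≤ j * τ →
      ∃ t, (c t x : ℕ) < τ := by
  -- Shift `t` moves the block of positions from `t * τ` to the front. The block containing `x`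
  -- starts at or before `x`, so the subtraction does not wrap around.
  refine ⟨fun t => Equiv.subRight (Fin.ofNat m (t * τ)), fun x k hxk hk => ?_⟩
  have hdiv : (x : ℕ) / τ < j := (Nat.div_lt_iff_lt_mul hτ).2 (lt_of_lt_of_le hxk hk)
  refine ⟨⟨x / τ, hdiv⟩, ?_⟩
  have hle : (x : ℕ) / τ * τ ≤ x := Nat.div_mul_le_self _ _
  have hval : ((Fin.ofNat m ((x : ℕ) / τ * τ) : Fin m) : ℕ) = (x : ℕ) / τ * τ := by
    simpa using Nat.mod_eq_of_lt (lt_of_le_of_lt hle x.isLt)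
  simp only [Equiv.subRight_apply]
  rw [Fin.sub_val_of_le (Fin.le_def.2 (by rw [hval]; exact hle)), hval]
  have := Nat.div_add_mod (x : ℕ) τ
  have hmod := Nat.mod_lt (x : ℕ) hτ
  rw [mul_comm] at this
  omega

/-- Each of the `j` blocks can be shifted to the front, since relabelling positions keeps a uniform
profile uniform. The factor `ind (1 ≤ k i)` survives because agents without approvals must stay
excluded when `τ = 1`. -/
lemma profileAvg_supLoad_lt_le {n m : ℕ} [NeZero m] (k : Fin n → ℕ) (τ j : ℕ) (hτ : 1 ≤ τ) :
    profileAvg (fun P : Profile n m =>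
      supLoad fun i a => ind ((P i a : ℕ) < k i) * ind (k i ≤ j * τ)) ≤
    j * profileAvg fun P : Profile n m =>
      supLoad fun i a => ind (1 ≤ k i) * ind ((P i a : ℕ) < τ) := by
  obtain ⟨c, hc⟩ := exists_shift_cover m τ j hτ
  set f : Profile n m → ℝ≥0∞ := fun P =>
    supLoad fun i a => ind (1 ≤ k i) * ind ((P i a : ℕ) < τ) with hf
  calc _ ≤ profileAvg fun P : Profile n m => ∑ t, f ((fun _ => c t) * P) := by
        refine profileAvg_mono fun P => le_trans (supLoad_mono fun i a => ?_)
          (supLoad_sum_le Finset.univ fun t i a =>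
            ind (1 ≤ k i) * ind ((c t (P i a) : ℕ) < τ))
        by_cases h1 : (P i a : ℕ) < k i
        · by_cases h2 : k i ≤ j * τ
          · obtain ⟨t, ht⟩ := hc (P i a) (k i) h1 h2
            refine le_trans ?_ (Finset.single_le_sum (fun _ _ => zero_le) (Finset.mem_univ t))
            rw [ind_of h1, ind_of h2, ind_of ht, ind_of (by omega)]
          · simp [ind_of_not h2]
        · simp [ind_of_not h1]
    _ = _ := by
        rw [profileAvg_sum]
        simp only [profileAvg_comp_mul_left]
        simp

/-- On average, the agents who approve of something are represented well by those who answer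
positively. -/
lemma lintegral_profileAvg_le_impliedMax {n m : ℕ} [NeZero m] (F : Measure ℝ≥0)
    [IsProbabilityMeasure F] (l : ℝ≥0) {τ : ℕ} (hτ : τ = queryPos m (tailProb F l)) :
    ENNReal.ofReal (2 / 25) * ∫⁻ v, profileAvg (fun P : Profile n m =>
        supLoad fun i a => ind (1 ≤ countGE l (v i)) * ind ((P i a : ℕ) < τ))
        ∂valuationLaw n m F ≤
      ∫⁻ v, profileAvg (impliedMax l τ v) ∂valuationLaw n m F := by
  -- If `τ = 1`, approving something already means answering positively, and nothing is lost.
  rcases le_or_gt ⌊tailProb F l * m⌋₊ 1 with h1 | h1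
  · have : τ = 1 := by rw [hτ, queryPos, max_eq_left h1]
    rw [this]
    refine le_trans (mul_le_of_le_one_left' ?_) le_rfl
    rw [ENNReal.ofReal_le_one]; norm_num
  · have hτ' : τ = ⌊tailProb F l * m⌋₊ := by rw [hτ, queryPos, max_eq_right h1.le]
    rw [lintegral_profileAvg _ (measurable_impliedMax l τ)]
    calc _ ≤ ENNReal.ofReal (2 / 25) * ∫⁻ _, profileAvg (fun P : Profile n m =>
        supLoad fun i a => ind ((P i a : ℕ) < τ)) ∂valuationLaw n m F := by
          gcongr with v
          refine profileAvg_mono fun P => supLoad_mono fun i a => mul_le_of_le_one_left' ?_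
          exact ind_le_one _
      _ = profileAvg fun P : Profile n m =>
          ENNReal.ofReal (2 / 25) * supLoad fun i a => ind ((P i a : ℕ) < τ) := by
          rw [lintegral_const, measure_univ, mul_one, profileAvg_const_mul]
      _ ≤ _ := profileAvg_mono fun P => ?_
    -- The best `a` for the fixed profile is chosen independently of `v`; each agent counted for it
    -- answers positively with probability at least 2/25.
    obtain ⟨a, ha⟩ := exists_supLoad_eq fun (i : Fin n) (a : Fin m) => ind ((P i a : ℕ) < τ)
    rw [ha, Finset.mul_sum]
    calc _ ≤ ∑ i, ∫⁻ v, ind (τ ≤ countGE l (v i)) * ind ((P i a : ℕ) < τ)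
          ∂valuationLaw n m F := by
          refine Finset.sum_le_sum fun i _ => ?_
          have hm : Measurable fun v : Valuations n m => ind (τ ≤ countGE l (v i)) :=
            measurable_ind_countGE l i (Set.Ici τ)
          rw [lintegral_mul_const _ hm]
          gcongr
          have hA : MeasurableSet {u : Fin m → ℝ≥0 | τ ≤ countGE l u} :=
            measurableSet_le measurable_const (measurable_countGE l)
          have h3 := (measurePreserving_eval
            (fun _ : Fin n => Measure.pi fun _ : Fin m => F) i).lintegral_comp (measurable_ind hA)
          rw [lintegral_ind _ hA] at h3
          refine le_trans ?_ h3.ge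
          have h4 := measureReal_floor_le_countGE (m := m) F l
          rw [← hτ'] at h4
          exact (ENNReal.ofReal_le_iff_le_toReal (measure_ne_top _ _)).2 h4
      _ = ∫⁻ v, ∑ i, ind (τ ≤ countGE l (v i)) * ind ((P i a : ℕ) < τ) ∂valuationLaw n m F :=
          (lintegral_finsetSum _ fun i _ =>
            (measurable_ind_countGE l i (Set.Ici τ)).mul_const _).symm
      _ ≤ _ := lintegral_mono fun v =>
          le_supLoad (fun i a => ind (τ ≤ countGE l (v i)) * ind ((P i a : ℕ) < τ)) a

/-- For binary values, the maximum implied welfare is a constant fraction of the optimum. -/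
lemma lintegral_supLoad_le_impliedMax {n m : ℕ} [NeZero m] (F : Measure ℝ≥0)
    [IsProbabilityMeasure F] (l : ℝ≥0) :
    ∫⁻ v, supLoad (fun i a => ind (l ≤ v i a)) ∂valuationLaw n m F ≤
      150 * ∫⁻ v, consistentAvg v (impliedMax l (queryPos m (tailProb F l)) v)
        ∂valuationLaw n m F := by
  set τ := queryPos m (tailProb F l) with hτ
  have hτ1 : 1 ≤ τ := one_le_queryPos _ _
  -- Since `p * m < τ + 1` and `1 ≤ τ`, the left side is at most `2 * (τ + 2) ≤ 6 * τ`.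
  have hK : 2 * (1 + m * F (Set.Ici l)) ≤ ((6 * τ : ℕ) : ℝ≥0∞) := by
    have h1 : tailProb F l * m < τ + 1 := by
      refine lt_of_lt_of_le (Nat.lt_floor_add_one _) ?_
      have : ⌊tailProb F l * m⌋₊ ≤ τ := le_max_right _ _
      gcongr
    have h2 : (1 : ℝ) ≤ τ := by exact_mod_cast hτ1
    have h3 : F (Set.Ici l) = ENNReal.ofReal (tailProb F l) := by
      simp [tailProb]
    have hp : 0 ≤ tailProb F l := measureReal_nonneg
    calc 2 * (1 + m * F (Set.Ici l))
        = ENNReal.ofReal (2 * (1 + m * tailProb F l)) := by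
          rw [h3, ENNReal.ofReal_mul (by norm_num), ENNReal.ofReal_add (by norm_num) (by positivity),
            ENNReal.ofReal_mul (by positivity)]
          simp
      _ ≤ ENNReal.ofReal ((6 * τ : ℕ) : ℝ) := by
          refine ENNReal.ofReal_le_ofReal ?_
          push_cast
          nlinarith
      _ = _ := by simp
  have hmeas : ∀ P : Profile n m, Measurable fun v : Valuations n m =>
      supLoad fun i a => ind ((P i a : ℕ) < countGE l (v i)) * ind (countGE l (v i) ≤ 6 * τ) :=
    fun P => measurable_supLoad fun i a => (measurable_ind_countGE l i (Set.Ioi _)).mul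
      (measurable_ind_countGE l i (Set.Iic _))
  refine (lintegral_supLoad_le_truncated F l (6 * τ) hK).trans ?_
  have hsymm : ∫⁻ v, supLoad (fun i a => ind (l ≤ v i a) * ind (countGE l (v i) ≤ 6 * τ))
      ∂valuationLaw n m F = ∫⁻ v, profileAvg (fun P : Profile n m => supLoad fun i a =>
        ind ((P i a : ℕ) < countGE l (v i)) * ind (countGE l (v i) ≤ 6 * τ))
        ∂valuationLaw n m F := by
    rw [← lintegral_consistentAvg F hmeas fun v Q => by simp only [permute, countGE_comp_perm]]
    refine lintegral_congr fun v => ?_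
    refine (consistentAvg_const v _).symm.trans (consistentAvg_congr v fun P hP => ?_)
    simp only [(mem_consistentProfiles.1 hP _).le_iff]
  rw [hsymm, lintegral_consistentAvg F (measurable_impliedMax l τ)
    fun v Q => impliedMax_permute l τ v Q]
  set M := ∫⁻ v, profileAvg (fun P : Profile n m =>
        supLoad fun i a => ind (1 ≤ countGE l (v i)) * ind ((P i a : ℕ) < τ))
        ∂valuationLaw n m F with hM
  have hle : ∫⁻ v, profileAvg (fun P : Profile n m => supLoad fun i a =>
        ind ((P i a : ℕ) < countGE l (v i)) * ind (countGE l (v i) ≤ 6 * τ))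
        ∂valuationLaw n m F ≤ 6 * M := by
    rw [hM, ← lintegral_const_mul' _ _ (by simp)]
    exact lintegral_mono fun v => by
      simpa using profileAvg_supLoad_lt_le (fun i => countGE l (v i)) τ 6 hτ1
  calc _ ≤ 2 * (6 * M) := by gcongr
    -- Truncation costs 2, covering 6 and anti-concentration 25/2.
    _ = 150 * (ENNReal.ofReal (2 / 25) * M) := by
        rw [← mul_assoc, ← mul_assoc]
        congr 1
        rw [show (150 : ℝ≥0∞) = ENNReal.ofReal 150 by simp, ← ENNReal.ofReal_mul (by norm_num)]
        norm_num
    _ ≤ _ := by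
        gcongr
        exact lintegral_profileAvg_le_impliedMax F l hτ

/-! ### Welfare achieved by the mechanism -/

/-- The welfare of an alternative of maximum implied welfare. -/
lemma mul_impliedMax_le_socialWelfare {n m : ℕ} [NeZero m] (l : ℝ≥0) {p : ℝ} (hp : p ≤ 1)
    {S : Profile n m → (Fin n → ℝ≥0) → Fin m} (hS : IsMeanRule p S) {v : Valuations n m}
    {P : Profile n m} (hP : P ∈ consistentProfiles v) :
    l * impliedMax l (queryPos m p) v P ≤
      socialWelfare (S P fun i => binarize l (answers P v (queryPos m p) i)) v := by
  set τ := queryPos m p with hτ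
  have hτ1 : 1 ≤ τ := one_le_queryPos m p
  have hτm : τ ≤ m := queryPos_le hp
  set x : Fin n → ℝ≥0 := fun i => binarize l (answers P v τ i) with hx
  rw [mem_consistentProfiles] at hP
  -- Position `τ` is place `τ - 1` counted from 0; the reduction modulo `m` in `altAt` is harmless
  -- because `τ ≤ m`.
  have hx1 : ∀ i, x i = 1 ↔ τ ≤ countGE l (v i) := fun i => by
    have h1 : x i = 1 ↔ l ≤ v i (altAt (P i) τ) := by
      simp only [hx, binarize, answers]
      by_cases h : l ≤ v i (altAt (P i) τ) <;> simp [h]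
    rw [h1, (hP i).le_iff, altAt, Equiv.apply_symm_apply, Fin.val_ofNat,
      Nat.mod_eq_of_lt (by omega)]
    omega
  have himp : ∀ a, (impliedWelfare a P x τ : ℝ≥0∞) =
      ∑ i, ind (τ ≤ countGE l (v i)) * ind ((P i a : ℕ) < τ) := fun a => by
    unfold impliedWelfare
    push_cast
    refine Finset.sum_congr rfl fun i _ => ?_
    rw [← ind_and]
    by_cases h : τ ≤ countGE l (v i) ∧ (P i a : ℕ) < τ
    · rw [ind_of h, if_pos ⟨(hx1 i).2 h.1, h.2⟩]
    · rw [ind_of_not h, if_neg fun h' => h ⟨(hx1 i).1 h'.1, h'.2⟩]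
  have hmax : impliedMax l τ v P ≤ impliedWelfare (S P x) P x τ := by
    refine supLoad_le fun a => ?_
    rw [← himp]
    exact_mod_cast hS P x a
  calc l * impliedMax l τ v P ≤ l * impliedWelfare (S P x) P x τ := by gcongr
    _ ≤ _ := by
        rw [himp, Finset.mul_sum, socialWelfare, ENNReal.ofNNReal_finsetSum]
        refine Finset.sum_le_sum fun i _ => ?_
        -- A positive answer certifies value at least `l` for all of the first `τ` alternatives, so
        -- every counted agent really contributes `l`.
        by_cases h : τ ≤ countGE l (v i) ∧ (P i (S P x) : ℕ) < τ
        · rw [ind_of h.1, ind_of h.2, mul_one, mul_one]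
          exact_mod_cast ((hP i).le_iff l _).2 (h.2.trans_le h.1)
        · rw [← ind_and, ind_of_not h, mul_zero]
          exact zero_le

lemma sum_uniformOfFintype_map_mul {m k : ℕ} [NeZero k] (g : Fin k → Fin m) (f : Fin m → ℝ≥0∞) :
    ∑ a, (PMF.uniformOfFintype (Fin k)).map g a * f a = (k : ℝ≥0∞)⁻¹ * ∑ t, f (g t) := by
  simp only [PMF.map_apply, tsum_fintype, Finset.sum_mul, PMF.uniformOfFintype_apply,
    Fintype.card_fin]
  rw [Finset.sum_comm, Finset.mul_sum]
  refine Finset.sum_congr rfl fun t _ => ?_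
  simp

lemma consistentAvg_const_mul {n m : ℕ} (v : Valuations n m) (c : ℝ≥0∞)
    (f : Profile n m → ℝ≥0∞) : consistentAvg v (fun P => c * f P) = c * consistentAvg v f := by
  unfold consistentAvg
  rw [← Finset.mul_sum, mul_left_comm]

lemma consistentAvg_sum {n m : ℕ} {ι : Type*} (v : Valuations n m) (s : Finset ι)
    (f : ι → Profile n m → ℝ≥0∞) :
    consistentAvg v (fun P => ∑ j ∈ s, f j P) = ∑ j ∈ s, consistentAvg v (f j) := by
  unfold consistentAvg
  rw [Finset.sum_comm, Finset.mul_sum]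

lemma le_expectedWelfare_rtMean {n m k : ℕ} [NeZero m] [NeZero k] (F : Measure ℝ≥0)
    [IsProbabilityMeasure F] (l : Fin k → ℝ≥0) (S : Fin k → Profile n m → (Fin n → ℝ≥0) → Fin m)
    (hS : ∀ t, IsMeanRule (tailProb F (l t)) (S t)) :
    (k : ℝ≥0∞)⁻¹ * ∑ t, l t * ∫⁻ v, consistentAvg v
      (impliedMax (l t) (queryPos m (tailProb F (l t))) v) ∂valuationLaw n m F ≤
    expectedWelfare (rtMean F l S) F := by
  have hm : ∀ t, Measurable fun v : Valuations n m =>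
      consistentAvg v (impliedMax (l t) (queryPos m (tailProb F (l t))) v) := fun t =>
    measurable_consistentAvg (measurable_impliedMax _ _)
  simp only [← lintegral_const_mul _ (hm _)]
  rw [← lintegral_finsetSum _ fun t _ => (hm t).const_mul _, ← lintegral_const_mul _
    (Finset.measurable_sum _ fun t _ => (hm t).const_mul _)]
  refine lintegral_mono fun v => ?_
  simp only [← consistentAvg_const_mul, ← consistentAvg_sum]
  refine consistentAvg_mono v fun P hP => ?_
  simp only [winnerWelfare, rtMean]
  rw [sum_uniformOfFintype_map_mul]
  gcongr with t
  exact mul_impliedMax_le_socialWelfare (l t) measureReal_le_one (hS t) hP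

/-! ### Dyadic decomposition of the optimum and its tail -/

/-- Either `z < c`, or twice the largest threshold not above `z` already exceeds `z`. -/
lemma le_dyadic_of_lt {c z : ℝ≥0} (k : ℕ) (h : z < c * 2 ^ k) :
    (z : ℝ≥0∞) ≤ c + 2 * ∑ t : Fin k, ((c * 2 ^ (t : ℕ) : ℝ≥0) : ℝ≥0∞) *
      ind (c * 2 ^ (t : ℕ) ≤ z) := by
  induction k with
  | zero => simpa using h.le
  | succ k ih =>
    rw [Fin.sum_univ_castSucc]
    simp only [Fin.val_castSucc, Fin.val_last]
    by_cases hz : c * 2 ^ k ≤ z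
    · rw [ind_of hz, mul_one, mul_add]
      refine le_trans ?_ (le_add_of_nonneg_left zero_le)
      refine le_trans ?_ (le_add_of_nonneg_left zero_le)
      have : z ≤ 2 * (c * 2 ^ k) := h.le.trans (by rw [pow_succ]; exact le_of_eq (by ring))
      exact_mod_cast this
    · refine (ih (not_le.1 hz)).trans ?_
      gcongr
      exact le_self_add

/-- A value is bounded by the sum of the dyadic thresholds below it, up to a small error and a
tail. -/
lemma le_dyadic (c z : ℝ≥0) (k : ℕ) :
    (z : ℝ≥0∞) ≤ (c + 2 * ∑ t : Fin k, ((c * 2 ^ (t : ℕ) : ℝ≥0) : ℝ≥0∞) *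
      ind (c * 2 ^ (t : ℕ) ≤ z)) + z * ind (c * 2 ^ k ≤ z) := by
  by_cases hz : c * 2 ^ k ≤ z
  · rw [ind_of hz, mul_one]
    exact le_add_of_nonneg_left zero_le
  · exact le_add_right (le_dyadic_of_lt k (not_le.1 hz))

lemma lintegral_eval_eval {n m : ℕ} (F : Measure ℝ≥0) [IsProbabilityMeasure F] (i : Fin n)
    (a : Fin m) {g : ℝ≥0 → ℝ≥0∞} (hg : Measurable g) :
    ∫⁻ v, g (v i a) ∂valuationLaw n m F = ∫⁻ z, g z ∂F := by
  have h1 := measurePreserving_eval (fun _ : Fin n => Measure.pi fun _ : Fin m => F) i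
  have h2 := measurePreserving_eval (fun _ : Fin m => F) a
  exact (h2.comp h1).lintegral_comp hg

lemma coe_maxWelfare_le {n m : ℕ} (v : Valuations n m) :
    (maxWelfare v : ℝ≥0∞) ≤ supLoad fun i a => (v i a : ℝ≥0∞) := by
  rcases Nat.eq_zero_or_pos m with rfl | hm
  · simp [maxWelfare]
  · have : NeZero m := ⟨hm.ne'⟩
    obtain ⟨a, -, ha⟩ := Finset.exists_mem_eq_sup (Finset.univ : Finset (Fin m))
      Finset.univ_nonempty fun a => socialWelfare a v
    rw [maxWelfare, ha, socialWelfare, ENNReal.ofNNReal_finsetSum]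
    exact le_supLoad (fun i a => (v i a : ℝ≥0∞)) a

lemma mul_lintegral_le_expectedMaxWelfare (n m : ℕ) [NeZero m] (F : Measure ℝ≥0)
    [IsProbabilityMeasure F] : n * ∫⁻ z, (z : ℝ≥0∞) ∂F ≤ expectedMaxWelfare n m F := by
  calc n * ∫⁻ z, (z : ℝ≥0∞) ∂F
      = ∑ i : Fin n, ∫⁻ v, (v i (0 : Fin m) : ℝ≥0∞) ∂valuationLaw n m F := by
        simp only [fun i => lintegral_eval_eval F i (0 : Fin m) measurable_coe_nnreal_ennreal
          (n := n)]
        simp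
    _ = ∫⁻ v, ∑ i : Fin n, (v i (0 : Fin m) : ℝ≥0∞) ∂valuationLaw n m F :=
        (lintegral_finsetSum _ fun i _ => by fun_prop).symm
    _ ≤ _ := by
        refine lintegral_mono fun v => ?_
        rw [← ENNReal.ofNNReal_finsetSum]
        exact ENNReal.coe_le_coe.2
          (Finset.le_sup (f := fun a => socialWelfare a v) (Finset.mem_univ 0))

/-- `le_dyadic` is applied entrywise, and `supLoad` is subadditive. In the tail term the maximum
over alternatives is bounded by the sum, whence the factor `m`. -/
lemma expectedMaxWelfare_le (n m k : ℕ) (F : Measure ℝ≥0) [IsProbabilityMeasure F] (c : ℝ≥0) :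
    expectedMaxWelfare n m F ≤ n * c +
      2 * ∑ t : Fin k, ((c * 2 ^ (t : ℕ) : ℝ≥0) : ℝ≥0∞) *
        ∫⁻ v, supLoad (fun i a => ind (c * 2 ^ (t : ℕ) ≤ v i a)) ∂valuationLaw n m F +
      n * (m * ∫⁻ z, z * ind (c * 2 ^ k ≤ z) ∂F) := by
  have hg : Measurable fun z : ℝ≥0 => (z : ℝ≥0∞) * ind (c * 2 ^ k ≤ z) :=
    measurable_coe_nnreal_ennreal.mul (measurable_ind measurableSet_Ici)
  have hO : ∀ t : Fin k, Measurable fun v : Valuations n m =>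
      supLoad (fun i a => ind (c * 2 ^ (t : ℕ) ≤ v i a)) := fun t =>
    measurable_supLoad fun i a => measurable_ind_le _ i a
  have htail : ∀ i a, Measurable fun v : Valuations n m =>
      (v i a : ℝ≥0∞) * ind (c * 2 ^ k ≤ v i a) := fun i a =>
    hg.comp ((measurable_pi_apply a).comp (measurable_pi_apply i))
  have hpt : ∀ v : Valuations n m, (maxWelfare v : ℝ≥0∞) ≤ n * c +
      2 * ∑ t : Fin k, ((c * 2 ^ (t : ℕ) : ℝ≥0) : ℝ≥0∞) *
        supLoad (fun i a => ind (c * 2 ^ (t : ℕ) ≤ v i a)) +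
      ∑ a, ∑ i, v i a * ind (c * 2 ^ k ≤ v i a) := by
    intro v
    refine (coe_maxWelfare_le v).trans ((supLoad_mono fun i a => le_dyadic c (v i a) k).trans ?_)
    refine (supLoad_add_le _ _).trans (add_le_add ((supLoad_add_le _ _).trans (add_le_add ?_ ?_)) ?_)
    · exact supLoad_le fun a => by simp
    · rw [supLoad_const_mul]
      gcongr
      refine (supLoad_sum_le _ fun t i a => _).trans ?_
      simp only [supLoad_const_mul]
      exact le_rfl
    · exact supLoad_le fun a => Finset.single_le_sum
        (f := fun a => ∑ i, (v i a : ℝ≥0∞) * ind (c * 2 ^ k ≤ v i a))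
        (fun _ _ => zero_le) (Finset.mem_univ a)
  refine (lintegral_mono hpt).trans (le_of_eq ?_)
  have hm2 := Finset.measurable_sum Finset.univ fun t (_ : t ∈ Finset.univ) =>
    (hO t).const_mul ((c * 2 ^ (t : ℕ) : ℝ≥0) : ℝ≥0∞)
  have hm3 := (measurable_const (a := (n : ℝ≥0∞) * c)).fun_add (hm2.const_mul 2)
  rw [lintegral_add_left hm3, lintegral_add_left measurable_const, lintegral_const, measure_univ,
    mul_one, lintegral_const_mul _ hm2, lintegral_finsetSum _ fun t _ => (hO t).const_mul _]
  simp only [lintegral_const_mul _ (hO _)]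
  congr 1
  rw [lintegral_finsetSum _ fun a _ => Finset.measurable_sum _ fun i _ => htail i a]
  simp only [lintegral_finsetSum _ fun i _ => htail i _, fun i a => lintegral_eval_eval F i a hg
    (n := n) (m := m)]
  simp only [Finset.sum_const, Finset.card_univ, Fintype.card_fin, nsmul_eq_mul]
  ring

/-- The contribution of large values to the mean is controlled by the variance. -/
lemma lintegral_tail_le {F : Measure ℝ≥0} [IsProbabilityMeasure F] {μ σ : ℝ}
    (hF : MemLp (fun z : ℝ≥0 => (z : ℝ)) 2 F) (hμ : ∫ z, (z : ℝ) ∂F = μ)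
    (hσ : Var[fun z : ℝ≥0 => (z : ℝ); F] = σ ^ 2) {L : ℝ≥0} (hL0 : 0 < L) (hL : 2 * μ ≤ L) :
    ∫⁻ z, z * ind (L ≤ z) ∂F ≤ ENNReal.ofReal (4 / L * σ ^ 2) := by
  have hLr : (0 : ℝ) < L := by exact_mod_cast hL0
  rw [ENNReal.ofReal_mul (by positivity), ← hσ, hF.ofReal_variance_eq, evariance, hμ,
    ← lintegral_const_mul' _ _ ENNReal.ofReal_ne_top]
  refine lintegral_mono fun z => ?_
  by_cases hz : L ≤ z
  · have hzr : (L : ℝ) ≤ z := by exact_mod_cast hz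
    rw [ind_of hz, mul_one, Real.enorm_eq_ofReal_abs, ← ENNReal.ofReal_pow (abs_nonneg _), sq_abs,
      ← ENNReal.ofReal_mul (by positivity), ← ENNReal.ofReal_coe_nnreal]
    refine ENNReal.ofReal_le_ofReal ?_
    rw [div_mul_eq_mul_div, le_div_iff₀ hLr]
    -- From `z ≥ L ≥ 2 * μ` follows `z ≤ z ^ 2 / L ≤ 4 * (z - μ) ^ 2 / L`.
    have h1 : (z : ℝ) / 2 ≤ z - μ := by linarith
    have h2 : ((z : ℝ) / 2) ^ 2 ≤ (z - μ) ^ 2 := by gcongr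
    nlinarith
  · rw [ind_of_not hz, mul_zero]; exact zero_le

lemma one_le_logRate (m : ℕ) (μ σ : ℝ) : 1 ≤ logRate m μ σ := by
  unfold logRate; split_ifs
  · exact le_rfl
  · exact le_max_left _ _

lemma mul_div_le_exp_logRate {m : ℕ} [NeZero m] {μ : ℝ} (hμ : 0 < μ) (σ : ℝ) :
    m * (σ ^ 2 / μ ^ 2) ≤ Real.exp (logRate m μ σ) := by
  by_cases hσ : σ = 0
  · simp [hσ, Real.exp_nonneg]
  · have hm : (0 : ℝ) < m := by exact_mod_cast Nat.pos_of_ne_zero (NeZero.ne m)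
    have hq : 0 < σ ^ 2 / μ ^ 2 := by positivity
    rw [logRate, if_neg hσ]
    calc m * (σ ^ 2 / μ ^ 2) = Real.exp (Real.log m + Real.log (σ ^ 2 / μ ^ 2)) := by
          rw [Real.exp_add, Real.exp_log hm, Real.exp_log hq]
      _ ≤ _ := Real.exp_le_exp.2 (le_max_right _ _)

/-- Here `64 = 2 ^ 6`, and `exp R ≤ 2 ^ (2 * R)` because `2 * log 2 > 1`. -/
lemma exp_le_two_pow_ceil {R : ℝ} (hR : 0 ≤ R) : 64 * Real.exp R ≤ 2 ^ ⌈6 + 2 * R⌉₊ := by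
  have h1 : 6 + 2 * R ≤ ⌈6 + 2 * R⌉₊ := Nat.le_ceil _
  have hlog := Real.log_two_gt_d9
  calc 64 * Real.exp R ≤ 64 * Real.exp (Real.log 2 * (2 * R)) := by
        gcongr; nlinarith
    _ = (2 : ℝ) ^ (6 + 2 * R) := by
        rw [Real.rpow_add (by norm_num), Real.rpow_def_of_pos (y := 2 * R) (by norm_num)]
        norm_num
    _ ≤ (2 : ℝ) ^ (⌈6 + 2 * R⌉₊ : ℝ) := Real.rpow_le_rpow_of_exponent_le (by norm_num) h1
    _ = _ := Real.rpow_natCast _ _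

end AvgDistortion

/-! ### Choice of thresholds and conclusion -/

theorem mainTheorem3 :
    ∃ C : ℝ, 0 < C ∧
      ∀ (F : Measure ℝ≥0) [IsProbabilityMeasure F] (μ σ : ℝ),
        MemLp (fun z : ℝ≥0 => (z : ℝ)) 2 F →
        ∫ z, (z : ℝ) ∂F = μ → 0 < μ →
        Var[fun z : ℝ≥0 => (z : ℝ); F] = σ ^ 2 →
        ∀ (m : ℕ) [NeZero m],
          ∃ (k : ℕ) (_ : NeZero k) (l : Fin k → ℝ≥0),
            (∀ t, 0 < l t) ∧ StrictMono l ∧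
            ∀ (n : ℕ) [NeZero n] (S : Fin k → Profile n m → (Fin n → ℝ≥0) → Fin m),
              (∀ t, IsMeanRule (tailProb F (l t)) (S t)) →
              avgDistortion (rtMean F l S) F ≤ ENNReal.ofReal (C * logRate m μ σ) := by
  -- 5400 = 4 * 150 * 9: absorbing the error terms, the binary case, and `k ≤ 9 * R`.
  refine ⟨5400, by norm_num, fun F _ μ σ hF hmean hμ hvar m _ => ?_⟩
  set R := logRate m μ σ with hR
  have hR1 : 1 ≤ R := one_le_logRate m μ σ
  -- Large enough that `2 ^ k ≥ 64 * m * σ² / μ²`, which bounds the tail by `μ / 4`.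
  set k := ⌈6 + 2 * R⌉₊ with hk
  have hk0 : k ≠ 0 := (Nat.ceil_pos.2 (by linarith)).ne'
  have hkR : (k : ℝ) ≤ 9 * R := by
    have := Nat.ceil_lt_add_one (show 0 ≤ 6 + 2 * R by linarith)
    rw [hk]; linarith
  have hexp : 64 * Real.exp R ≤ 2 ^ k := exp_le_two_pow_ceil (by linarith)
  have h8 : (8 : ℝ) ≤ 2 ^ k := by nlinarith [Real.one_le_exp (by linarith : 0 ≤ R)]
  have h64 : 64 * (m * (σ ^ 2 / μ ^ 2)) ≤ (2 : ℝ) ^ k :=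
    le_trans (by gcongr; exact mul_div_le_exp_logRate hμ σ) hexp
  have : NeZero k := ⟨hk0⟩
  set c : ℝ≥0 := (μ / 4).toNNReal with hc
  have hcr : (c : ℝ) = μ / 4 := Real.coe_toNNReal _ (by linarith)
  have hc0 : 0 < c := Real.toNNReal_pos.2 (by linarith)
  refine ⟨k, inferInstance, fun t => c * 2 ^ (t : ℕ), fun t => by positivity, ?_, ?_⟩
  · intro s t hst
    have : (2 : ℝ≥0) ^ (s : ℕ) < 2 ^ (t : ℕ) := pow_lt_pow_right₀ (by norm_num) hst
    exact mul_lt_mul_of_pos_left this hc0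
  intro n _ S hS
  have hL0 : 0 < c * 2 ^ k := by positivity
  have hLr : ((c * 2 ^ k : ℝ≥0) : ℝ) = μ / 4 * 2 ^ k := by push_cast; rw [hcr]
  have hL : 2 * μ ≤ (c * 2 ^ k : ℝ≥0) := by rw [hLr]; nlinarith
  have htail : m * ∫⁻ z, z * ind (c * 2 ^ k ≤ z) ∂F ≤ c := by
    calc _ ≤ m * ENNReal.ofReal (4 / (c * 2 ^ k : ℝ≥0) * σ ^ 2) := by
          gcongr
          exact lintegral_tail_le hF hmean hvar hL0 hL
      _ = ENNReal.ofReal (m * (4 / (c * 2 ^ k : ℝ≥0) * σ ^ 2)) := by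
          rw [ENNReal.ofReal_mul (p := (m : ℝ)) (by positivity), ENNReal.ofReal_natCast]
      _ ≤ ENNReal.ofReal (μ / 4) := by
          refine ENNReal.ofReal_le_ofReal ?_
          rw [hLr]
          have h2k : (0 : ℝ) < 2 ^ k := by positivity
          rw [show m * (4 / (μ / 4 * 2 ^ k) * σ ^ 2) =
            64 * (m * (σ ^ 2 / μ ^ 2)) / 2 ^ k * (μ / 4) by field_simp; ring]
          refine mul_le_of_le_one_left (by linarith) ?_
          rwa [div_le_one h2k]
      _ = c := rfl
  have hmean' : ∫⁻ z, (z : ℝ≥0∞) ∂F = 4 * c := by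
    have hint : Integrable (fun z : ℝ≥0 => (z : ℝ)) F := hF.integrable (by norm_num)
    have := ofReal_integral_eq_lintegral_ofReal hint (ae_of_all _ fun z => z.coe_nonneg)
    simp only [ENNReal.ofReal_coe_nnreal] at this
    rw [← this, hmean, show μ = 4 * (μ / 4) by ring, ENNReal.ofReal_mul (by norm_num), hc]
    simp [ENNReal.ofReal]
  set A : Fin k → ℝ≥0∞ := fun t => ∫⁻ v, consistentAvg v (impliedMax (c * 2 ^ (t : ℕ))
    (queryPos m (tailProb F (c * 2 ^ (t : ℕ)))) v) ∂valuationLaw n m F with hA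
  set X : ℝ≥0∞ := ∑ t : Fin k, ((c * 2 ^ (t : ℕ) : ℝ≥0) : ℝ≥0∞) *
    ∫⁻ v, supLoad (fun i a => ind (c * 2 ^ (t : ℕ) ≤ v i a)) ∂valuationLaw n m F with hX
  have hXA : X ≤ 150 * ∑ t : Fin k, ((c * 2 ^ (t : ℕ) : ℝ≥0) : ℝ≥0∞) * A t := by
    rw [hX, Finset.mul_sum]
    refine Finset.sum_le_sum fun t _ => ?_
    rw [mul_left_comm]
    gcongr
    exact lintegral_supLoad_le_impliedMax F _
  have hup : expectedMaxWelfare n m F ≤ 2 * (n * c) + 2 * X := by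
    refine (expectedMaxWelfare_le n m k F c).trans ?_
    calc _ ≤ n * c + 2 * X + n * c := by gcongr
      _ = _ := by ring
  have hlow : 2 * (n * (c : ℝ≥0∞)) + 2 * (n * c) ≤ expectedMaxWelfare n m F := by
    refine le_trans (le_of_eq ?_) (mul_lintegral_le_expectedMaxWelfare n m F)
    rw [hmean']; ring
  have hfin : 2 * (n * (c : ℝ≥0∞)) ≠ ∞ :=
    ENNReal.mul_ne_top (by simp) (ENNReal.mul_ne_top (by simp) ENNReal.coe_ne_top)
  -- The two error terms total `2 * n * c`, half of the lower bound `4 * n * c = n * μ` on the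
  -- optimum, so the dyadic part dominates them.
  have hncX : 2 * (n * (c : ℝ≥0∞)) ≤ 2 * X :=
    (ENNReal.add_le_add_iff_left hfin).1 (hlow.trans hup)
  have hALG := le_expectedWelfare_rtMean F (fun t : Fin k => c * 2 ^ (t : ℕ)) S hS
  refine ENNReal.div_le_of_le_mul ?_
  calc expectedMaxWelfare n m F ≤ 2 * X + 2 * X := hup.trans (by gcongr)
    _ = 4 * X := by ring
    _ ≤ 4 * (150 * ∑ t : Fin k, ((c * 2 ^ (t : ℕ) : ℝ≥0) : ℝ≥0∞) * A t) := by gcongr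
    _ = 600 * k * ((k : ℝ≥0∞)⁻¹ * ∑ t : Fin k, ((c * 2 ^ (t : ℕ) : ℝ≥0) : ℝ≥0∞) * A t) := by
        rw [mul_assoc 600, ← mul_assoc (k : ℝ≥0∞), ENNReal.mul_inv_cancel (by simpa using hk0)
          (by simp), one_mul, ← mul_assoc]
        norm_num
    _ ≤ ENNReal.ofReal (5400 * R) * expectedWelfare _ F := by
        refine mul_le_mul' ?_ hALG
        rw [show (600 : ℝ≥0∞) * k = ENNReal.ofReal (600 * k) by
          rw [ENNReal.ofReal_mul (by norm_num)]; simp]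
        exact ENNReal.ofReal_le_ofReal (by linarith)
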